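/- Let $\mathfrak{M}$ be an $n$-dimensional matchbox manifold: a compact connected metric space with a finite foliated atlas $\varphi_i\colon \overline{U}_i \to [-1,1]^n\times \mathfrak{T}_i$, where the $\mathfrak{T}_i$ are totally disconnected, the open sets $U_i=\varphi_i^{-1}((-1,1)^n\times\mathfrak{T}_i)$ cover $\mathfrak{M}$, each plaque of $U_i$ meets at most one plaque of $U_j$, and the sets $\varphi_i^{-1}(\{0\}\times\mathfrak{T}_i)$ are pairwise disjoint. (Smoothness along the leaves is not needed.) Let $\mathcal{G}^*$ be its holonomy pseudo$\star$group on $\mathfrak{T}=\bigsqcup_i\mathfrak{T}_i$: the local homeomorphisms generated by the transition maps $h_{i,j}$ under composition, inversion and restriction to open sets. Let $d_{\mathfrak T}$ be the metric on $\mathfrak T$ induced from $\mathfrak{M}$ on each $\mathfrak{T}_i$, with value $\infty$ between different $\mathfrak{T}_i$. Assume that $\mathfrak{M}$ is equicontinuous: for every $\epsilon>0$ there is $\delta>0$ such that for all $\gamma\in\mathcal{G}^*$ and all $z,w$ in the domain of $\gamma$, $d_{\mathfrak T}(z,w)<\delta$ implies $d_{\mathfrak T}(\gamma z,\gamma w)<\epsilon$.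 Assume that $\mathfrak{M}$ has a leaf (path component) with non-trivial holonomy, that is, some $\gamma\in\mathcal{G}^*$ fixes a point $y\in\mathfrak{T}$ of the leaf and its germ at $y$ is not the germ of the identity. Consider any transverse section: a clopen set $V_0\subset\mathfrak{T}$, a group $G_0$ acting on $V_0$ by homeomorphisms and generating the restriction of $\mathcal{G}^*$ to $V_0$ (the germs of the maps $v\mapsto g\cdot v$, $g \in G_0$, at points of $V_0$ are exactly the germs of elements of $\mathcal{G}^*$ that map a point of $V_0$ into $V_0$), a point $x\in V_0$, and clopen sets $V_0\supset V_1\supset\cdots$ with $\bigcap_\ell V_\ell=\{x\}$ such that, for each $\ell$, the translates $gV_\ell$, $g \in G_0$, form a finite partition of $V_0$, with $\sup_{g}\operatorname{diam}(gV_\ell)\to0$ as $\ell \to \infty$. Let $G_\ell=\{g\in G_0: gV_\ell=V_\ell\}$ be the associated group chain. Then: 1. For every $k\ge0$ the discriminant group of the truncated chain $\{G_\ell\}_{\ell\ge k}$, $$\mathcal{D}^k=\varprojlim_{\ell\ge k} G_\ell/E_{k,\ell},\qquad E_{k,\ell}=\bigcap_{g\in G_k}gG_\ell g^{-1},$$ is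 non-trivial. 2. The Molino sequence of the section has non-trivial fibre. That is, let $\mathcal{P}=\{p_{\ell+1}\colon M_{\ell+1}\to M_\ell\}_{\ell \ge 0}$ be a presentation (covering maps of degree $>1$ between closed connected $n$-manifolds) with weak solenoid $\mathcal{S}_{\mathcal P}=\varprojlim M_\ell$, let $\Theta\colon\mathfrak{M}\to\mathcal{S}_{\mathcal P}$ be a homeomorphism that maps each $V_\ell$ onto the set of points of $\mathcal{S}_{\mathcal P}$ whose $\ell$-th coordinate is that of $\Theta(x)=(x_\ell)$, and let $G_0\cong\pi_1(M_0,x_0)$ be an isomorphism under which the action on $V_0$ is the monodromy action. Let $C_\ell$ be the core in $\pi_1(M_0,x_0)$ of the image of $\pi_1(M_\ell,x_\ell)$, let $\widehat{M}_\ell\to M_0$ be the covering associated to $C_\ell$, and let $\widehat{q}\colon\widehat{\mathcal S}_{\mathcal P}=\varprojlim\widehat{M}_\ell\to\mathcal{S}_{\mathcal P}$ be the induced map from the Molino space. Then every fibre of $\widehat{q}$ has more than one point. -/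

import Mathlib

open Set Filter Topology

universe u

noncomputable section

/-! ## Group chains and their discriminants -/

/-- A group chain in `G`: a descending chain `G = G₀ ⊇ G₁ ⊇ ⋯` of subgroups of finite index. -/
structure GroupChain (G : Type*) [Group G] where
  sub : ℕ → Subgroup G
  sub_zero : sub 0 = ⊤
  anti : Antitone sub
  finiteIndex : ∀ l, (sub l).FiniteIndex

namespace GroupChain

variable {G : Type*} [Group G] (H : GroupChain G)

/-- The core `C_l`: the largest normal subgroup of `G` that is contained in `G_l`. -/
def core (l : ℕ) : Subgroup G := (H.sub l).normalCore

instance core_normal (l : ℕ) : (H.core l).Normal := Subgroup.normalCore_normal _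

theorem core_succ_le (l : ℕ) : H.core (l + 1) ≤ H.core l :=
  Subgroup.normalCore_mono (H.anti (Nat.le_succ l))

/-- The bonding homomorphism `G ⧸ C_{l+1} → G ⧸ C_l`. -/
def bond (l : ℕ) : G ⧸ H.core (l + 1) →* G ⧸ H.core l :=
  QuotientGroup.map _ _ (MonoidHom.id G) (H.core_succ_le l)

/-- The discriminant group of the chain: the inverse limit of the groups `G_l ⧸ C_l`, realised as
the subgroup of `∏ G ⧸ C_l` of the bond-compatible sequences whose `l`-th entry lies in the image
`G_l ⧸ C_l` of `G_l`. -/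
def discriminant : Subgroup (∀ l, G ⧸ H.core l) where
  carrier := {d | (∀ l, d l ∈ (H.sub l).map (QuotientGroup.mk' (H.core l))) ∧
    ∀ l, H.bond l (d (l + 1)) = d l}
  one_mem' := ⟨fun _ => Subgroup.one_mem _, fun _ => map_one _⟩
  mul_mem' := fun {a b} ha hb => ⟨fun l => Subgroup.mul_mem _ (ha.1 l) (hb.1 l), fun l => by
    rw [Pi.mul_apply, map_mul, ha.2 l, hb.2 l, Pi.mul_apply]⟩
  inv_mem' := fun {a} ha => ⟨fun l => Subgroup.inv_mem _ (ha.1 l), fun l => by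
    rw [Pi.inv_apply, map_inv, ha.2 l, Pi.inv_apply]⟩

/-- The truncated chain `G_n ⊇ G_{n+1} ⊇ ⋯`, a group chain in the group `G_n`. -/
def truncate (n : ℕ) : GroupChain (H.sub n) where
  sub l := (H.sub (n + l)).subgroupOf (H.sub n)
  sub_zero := Subgroup.subgroupOf_self _
  anti := fun _ _ h => Subgroup.comap_mono (H.anti (Nat.add_le_add_left h n))
  finiteIndex l := by
    have := H.finiteIndex (n + l)
    infer_instance

end GroupChain

/-! ## Matchbox manifolds and their holonomy pseudo⋆group -/

/-- The closed cube `[-1,1]^n`. -/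
abbrev ClosedCube (n : ℕ) : Type := Set.Icc (-1 : Fin n → ℝ) 1

/-- The centre of the cube. -/
def ClosedCube.center (n : ℕ) : ClosedCube n :=
  ⟨0, fun _ => by simp, fun _ => by simp⟩

/-- A local foliation chart on `M`: a homeomorphism `φ` from a closed set (the closure of the chart
domain `U`) to `[-1,1]^n × T` with `T` totally disconnected, where the preimage `U` of
`(-1,1)^n × T` is open in `M`. -/
structure FoliationChart (M : Type u) [TopologicalSpace M] (n : ℕ) where
  T : Type u
  [topT : TopologicalSpace T]
  [totallyDisconnected : TotallyDisconnectedSpace T]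
  K : Set M
  isClosed_K : IsClosed K
  φ : K ≃ₜ ClosedCube n × T
  isOpen_U : IsOpen ((↑) '' {p : K | ∀ k, (φ p).1.1 k ∈ Set.Ioo (-1 : ℝ) 1} : Set M)

attribute [instance] FoliationChart.topT FoliationChart.totallyDisconnected

/-- The open chart domain `U = φ⁻¹((-1,1)^n × T)`. -/
def FoliationChart.U {M : Type u} [TopologicalSpace M] {n : ℕ} (C : FoliationChart M n) : Set M :=
  (↑) '' {p : C.K | ∀ k, (C.φ p).1.1 k ∈ Set.Ioo (-1 : ℝ) 1}

theorem FoliationChart.mem_K {M : Type u} [TopologicalSpace M] {n : ℕ} (C : FoliationChart M n)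
    {p : M} (hp : p ∈ C.U) : p ∈ C.K := by
  obtain ⟨q, _, rfl⟩ := hp
  exact q.2

/-- The local defining map `π = pr₂ ∘ φ`, on the open chart domain. Its fibres are the plaques. -/
def FoliationChart.plaque {M : Type u} [TopologicalSpace M] {n : ℕ} (C : FoliationChart M n)
    (p : C.U) : C.T := (C.φ ⟨p, C.mem_K p.2⟩).2

/-- A finite foliated atlas with leaf dimension `n` on `M`. Each plaque of one chart domain meets at
most one plaque of any other (this makes the holonomy maps well defined), and the embedded
transversals `φ_i⁻¹({0} × T_i)` are pairwise disjoint. -/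
structure FoliatedAtlas (M : Type u) [TopologicalSpace M] (n : ℕ) where
  ν : ℕ
  chart : Fin ν → FoliationChart M n
  cover : ⋃ i, (chart i).U = Set.univ
  regular : ∀ i j (p q : M) (hpi : p ∈ (chart i).U) (hpj : p ∈ (chart j).U)
    (hqi : q ∈ (chart i).U) (hqj : q ∈ (chart j).U),
    (chart i).plaque ⟨p, hpi⟩ = (chart i).plaque ⟨q, hqi⟩ →
    (chart j).plaque ⟨p, hpj⟩ = (chart j).plaque ⟨q, hqj⟩
  disjoint : ∀ i j, i ≠ j → ∀ (a : (chart i).T) (b : (chart j).T),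
    (((chart i).φ.symm (ClosedCube.center n, a) : (chart i).K) : M) ≠
      ((chart j).φ.symm (ClosedCube.center n, b) : (chart j).K)

namespace FoliatedAtlas

section Top

variable {M : Type u} [TopologicalSpace M] {n : ℕ} (A : FoliatedAtlas M n)

/-- The transverse space `𝔗 = 𝔗_1 ⊔ ⋯ ⊔ 𝔗_ν`. -/
abbrev Trans : Type u := Σ i, (A.chart i).T

/-- The embedding of the transverse space into `M`, onto `⋃ φ_i⁻¹({0} × T_i)`. -/
def emb (z : A.Trans) : M := ((A.chart z.1).φ.symm (ClosedCube.center n, z.2) : (A.chart z.1).K)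

/-- The local defining map of the `i`-th chart, with values in the transverse space. -/
def proj (i : Fin A.ν) (p : (A.chart i).U) : A.Trans := ⟨i, (A.chart i).plaque p⟩

/-- `A.HolRel i j z w`: some point of `U_i ∩ U_j` lies on the plaque `z` of the `i`-th chart and on
the plaque `w` of the `j`-th chart. This is the graph of `h_{i,j} = π_j ∘ π_i⁻¹`. -/
def HolRel (i j : Fin A.ν) (z w : A.Trans) : Prop :=
  ∃ (p : M) (hi : p ∈ (A.chart i).U) (hj : p ∈ (A.chart j).U),
    z = A.proj i ⟨p, hi⟩ ∧ w = A.proj j ⟨p, hj⟩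

theorem HolRel.symm {i j : Fin A.ν} {z w : A.Trans} (h : A.HolRel i j z w) : A.HolRel j i w z := by
  obtain ⟨p, hi, hj, h1, h2⟩ := h
  exact ⟨p, hj, hi, h2, h1⟩

theorem HolRel.unique {i j : Fin A.ν} {z w w' : A.Trans} (h : A.HolRel i j z w)
    (h' : A.HolRel i j z w') : w = w' := by
  obtain ⟨p, hi, hj, h1, rfl⟩ := h
  obtain ⟨q, hi', hj', h1', rfl⟩ := h'
  rw [h1] at h1'
  have := A.regular i j p q hi hj hi' hj' (by simpa [proj] using h1')
  simp [proj, this]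

open Classical in
/-- The map `h_{i,j}`, extended by the identity outside of its domain. -/
def holFun (i j : Fin A.ν) (z : A.Trans) : A.Trans :=
  if h : ∃ w, A.HolRel i j z w then h.choose else z

theorem HolRel.holFun_eq {i j : Fin A.ν} {z w : A.Trans} (h : A.HolRel i j z w) :
    A.holFun i j z = w := by
  have hex : ∃ w, A.HolRel i j z w := ⟨w, h⟩
  rw [holFun, dif_pos hex]
  exact HolRel.unique A hex.choose_spec h

/-- The domain `𝔗_{i,j} = π_i(U_i ∩ U_j)` of `h_{i,j}`. -/
def holDom (i j : Fin A.ν) : Set A.Trans := {z | ∃ w, A.HolRel i j z w}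

theorem HolRel.exists_local {i j : Fin A.ν} {z w : A.Trans} (h : A.HolRel i j z w) :
    ∃ (s : Type u) (_ : TopologicalSpace s) (e : s → A.Trans) (f : s → A.Trans) (a : s),
      IsOpenEmbedding e ∧ Continuous f ∧ e a = z ∧ ∀ b, A.HolRel i j (e b) (f b) := by
  obtain ⟨p, hi, hj, rfl, rfl⟩ := h
  set C := A.chart i with hC
  set c : ClosedCube n × C.T := C.φ ⟨p, C.mem_K hi⟩ with hc
  have hcint : ∀ k, c.1.1 k ∈ Set.Ioo (-1 : ℝ) 1 := by
    obtain ⟨q, hq, rfl⟩ := hi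
    exact hq
  let G : C.T → M := fun a => (C.φ.symm (c.1, a) : C.K)
  have hG : Continuous G := by fun_prop
  have hGU : ∀ a, G a ∈ C.U := fun a => ⟨C.φ.symm (c.1, a), by simpa using hcint, rfl⟩
  have hGpl : ∀ a, C.plaque ⟨G a, hGU a⟩ = a := by
    intro a
    simp [FoliationChart.plaque, G]
  have hGa : G c.2 = p := by
    simp [G, hc]
  let s : Set C.T := G ⁻¹' (A.chart j).U
  have hs : IsOpen s := (A.chart j).isOpen_U.preimage hG
  refine ⟨s, inferInstance, fun a => ⟨i, a.1⟩, fun a => A.proj j ⟨G a.1, a.2⟩,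
    ⟨c.2, by simpa [s, hGa] using hj⟩, ?_, ?_, ?_, ?_⟩
  · exact IsOpenEmbedding.sigmaMk.comp hs.isOpenEmbedding_subtypeVal
  · refine continuous_sigmaMk.comp ?_
    unfold FoliationChart.plaque
    refine continuous_snd.comp ((A.chart j).φ.continuous.comp ?_)
    exact Continuous.subtype_mk (hG.comp continuous_subtype_val) _
  · rfl
  · intro b
    exact ⟨G b.1, hGU b.1, b.2, by simp only [proj]; rw [hGpl], rfl⟩

theorem isOpen_holDom (i j : Fin A.ν) : IsOpen (A.holDom i j) := by
  rw [isOpen_iff_mem_nhds]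
  rintro z ⟨w, h⟩
  obtain ⟨s, _, e, f, a, he, -, rfl, hef⟩ := HolRel.exists_local A h
  exact Filter.mem_of_superset (he.isOpen_range.mem_nhds ⟨a, rfl⟩)
    (by rintro _ ⟨b, rfl⟩; exact ⟨f b, hef b⟩)

theorem continuousOn_holFun (i j : Fin A.ν) : ContinuousOn (A.holFun i j) (A.holDom i j) := by
  rintro z ⟨w, h⟩
  obtain ⟨s, _, e, f, a, he, hf, rfl, hef⟩ := HolRel.exists_local A h
  refine ContinuousAt.continuousWithinAt ((he.continuousAt_iff).1 ?_)
  have : A.holFun i j ∘ e = f := funext fun b => HolRel.holFun_eq A (hef b)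
  rw [this]
  exact hf.continuousAt

/-- The elementary holonomy homeomorphism `h_{i,j} : 𝔗_{i,j} → 𝔗_{j,i}`. -/
def hol (i j : Fin A.ν) : OpenPartialHomeomorph A.Trans A.Trans where
  toFun := A.holFun i j
  invFun := A.holFun j i
  source := A.holDom i j
  target := A.holDom j i
  map_source' := by
    rintro z ⟨w, h⟩
    rw [HolRel.holFun_eq A h]
    exact ⟨z, HolRel.symm A h⟩
  map_target' := by
    rintro z ⟨w, h⟩
    rw [HolRel.holFun_eq A h]
    exact ⟨z, HolRel.symm A h⟩
  left_inv' := by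
    rintro z ⟨w, h⟩
    rw [HolRel.holFun_eq A h, HolRel.holFun_eq A (HolRel.symm A h)]
  right_inv' := by
    rintro z ⟨w, h⟩
    rw [HolRel.holFun_eq A h, HolRel.holFun_eq A (HolRel.symm A h)]
  open_source := A.isOpen_holDom i j
  open_target := A.isOpen_holDom j i
  continuousOn_toFun := A.continuousOn_holFun i j
  continuousOn_invFun := A.continuousOn_holFun j i

/-- The holonomy pseudo⋆group `𝒢*` of the atlas: the local homeomorphisms obtained from the
elementary holonomy maps by composition, inversion and restriction to open subsets (no gluing). -/
inductive PseudoStarGroup : OpenPartialHomeomorph A.Trans A.Trans → Prop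
  | hol (i j : Fin A.ν) : PseudoStarGroup (A.hol i j)
  | comp {f g : OpenPartialHomeomorph A.Trans A.Trans} :
      PseudoStarGroup f → PseudoStarGroup g → PseudoStarGroup (f.trans g)
  | symm {f : OpenPartialHomeomorph A.Trans A.Trans} :
      PseudoStarGroup f → PseudoStarGroup f.symm
  | restr {f : OpenPartialHomeomorph A.Trans A.Trans} (s : Set A.Trans) (hs : IsOpen s) :
      PseudoStarGroup f → PseudoStarGroup (f.restrOpen s hs)

/-- The leaf through `m`, that is, the path component of `m`, has non-trivial holonomy: at some
point `y` of the transverse space on that leaf, some holonomy map fixes `y` but has a germ at `y`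
different from the germ of the identity. -/
def LeafHasNontrivialHolonomy (m : M) : Prop :=
  ∃ y : A.Trans, A.emb y ∈ pathComponent m ∧
    ∃ γ, A.PseudoStarGroup γ ∧ y ∈ γ.source ∧ γ y = y ∧ ¬ (γ : A.Trans → A.Trans) =ᶠ[𝓝 y] id

end Top

section Metric

variable {M : Type u} [MetricSpace M] {n : ℕ} (A : FoliatedAtlas M n)

open Classical in
/-- The distance `d_𝔗` on the transverse space: the distance in `M` between points of the same
`𝔗_i`, and `∞` between points of different ones. -/
def transDist (z w : A.Trans) : ENNReal :=
  if z.1 = w.1 then edist (A.emb z) (A.emb w) else ⊤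

/-- Equicontinuity of the holonomy pseudo⋆group. -/
def Equicontinuous : Prop :=
  ∀ ε > 0, ∃ δ > 0, ∀ γ, A.PseudoStarGroup γ → ∀ z ∈ γ.source, ∀ w ∈ γ.source,
    A.transDist z w < δ → A.transDist (γ z) (γ w) < ε

end Metric

end FoliatedAtlas

/-! ## Transverse sections with their group chains -/

/-- A transverse section of an atlas with holonomy group `G` and base point `x`: a clopen set
`V 0` in the transverse space, an action `Φ` of a group `G` on `V 0` by homeomorphisms which
generates the restriction of the holonomy pseudo⋆group to `V 0`, and a descending sequence of clopen
sets `V l` with intersection `{x}`, whose `G`-translates form finite partitions of `V 0` of mesh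
tending to zero. -/
structure TransverseSection {M : Type u} [MetricSpace M] {n : ℕ} (A : FoliatedAtlas M n)
    (G : Type*) [Group G] where
  V : ℕ → Set A.Trans
  x : A.Trans
  isClopen : ∀ l, IsClopen (V l)
  anti : Antitone V
  iInter : ⋂ l, V l = {x}
  Φ : G →* (V 0 ≃ₜ V 0)
  /-- Every element of `G` acts near every point as a holonomy map. -/
  isHolonomy : ∀ (g : G) (v : V 0), ∃ γ, A.PseudoStarGroup γ ∧ (v : A.Trans) ∈ γ.source ∧
    ∀ᶠ w : V 0 in 𝓝 v, γ (w : A.Trans) = Φ g w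
  /-- Every holonomy map acts, near every point of `V 0` that it maps to `V 0`, as some element
  of `G`. -/
  generates : ∀ γ, A.PseudoStarGroup γ → ∀ v : V 0, (v : A.Trans) ∈ γ.source →
    γ (v : A.Trans) ∈ V 0 → ∃ g : G, ∀ᶠ w : V 0 in 𝓝 v, γ (w : A.Trans) = Φ g w
  finite : ∀ l, (Set.range fun g : G => Φ g '' ((↑) ⁻¹' V l)).Finite
  covers : ∀ l (v : V 0), ∃ g : G, v ∈ Φ g '' ((↑) ⁻¹' V l)
  disjoint : ∀ l (g h : G), (Φ g '' ((↑) ⁻¹' V l) ∩ Φ h '' ((↑) ⁻¹' V l)).Nonempty →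
    Φ g '' ((↑) ⁻¹' V l) = Φ h '' ((↑) ⁻¹' V l)
  mesh : ∀ ε > 0, ∃ L, ∀ l ≥ L, ∀ g : G, ∀ v ∈ Φ g '' ((↑) ⁻¹' V l),
    ∀ w ∈ Φ g '' ((↑) ⁻¹' V l), A.transDist v w < ε

namespace TransverseSection

variable {M : Type u} [MetricSpace M] {n : ℕ} {A : FoliatedAtlas M n} {G : Type*} [Group G]
  (S : TransverseSection A G)

/-- `V l` as a subset of `V 0`. -/
def W (l : ℕ) : Set (S.V 0) := (↑) ⁻¹' S.V l

theorem x_mem (l : ℕ) : S.x ∈ S.V l := by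
  have h : S.x ∈ ⋂ l, S.V l := by rw [S.iInter]; rfl
  exact Set.mem_iInter.1 h l

/-- The base point as a point of `V 0`. -/
def base : S.V 0 := ⟨S.x, S.x_mem 0⟩

/-- The stabilizer `G_l = {g | g V_l = V_l}`. -/
def stab (l : ℕ) : Subgroup G where
  carrier := {g | S.Φ g '' S.W l = S.W l}
  one_mem' := by
    change S.Φ 1 '' S.W l = S.W l
    rw [map_one]
    exact Set.image_id _
  mul_mem' := fun {a b} (ha : S.Φ a '' _ = _) (hb : S.Φ b '' _ = _) => by
    change S.Φ (a * b) '' S.W l = S.W l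
    have : (S.Φ (a * b) : S.V 0 → S.V 0) = S.Φ a ∘ S.Φ b := by
      rw [map_mul]; rfl
    rw [this, Set.image_comp, hb, ha]
  inv_mem' := fun {a} (ha : S.Φ a '' _ = _) => by
    change S.Φ a⁻¹ '' S.W l = S.W l
    have h : (S.Φ a⁻¹ : S.V 0 → S.V 0) ∘ S.Φ a = id := by
      change ((S.Φ a⁻¹ * S.Φ a : S.V 0 ≃ₜ S.V 0) : S.V 0 → S.V 0) = id
      rw [← map_mul, inv_mul_cancel, map_one]; rfl
    conv_lhs => rw [← ha]
    rw [← Set.image_comp, h, Set.image_id]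

theorem image_mul (a b : G) (s : Set (S.V 0)) : S.Φ (a * b) '' s = S.Φ a '' (S.Φ b '' s) := by
  rw [← Set.image_comp, map_mul]; rfl

theorem mem_stab_iff (l : ℕ) (g : G) : g ∈ S.stab l ↔ S.Φ g S.base ∈ S.W l := by
  have hb : S.base ∈ S.W l := S.x_mem l
  constructor
  · intro h
    have h' : S.Φ g '' S.W l = S.W l := h
    rw [← h']
    exact ⟨_, hb, rfl⟩
  · intro h
    have h1 : S.Φ (1 : G) '' S.W l = S.W l := by rw [map_one]; exact Set.image_id _
    have := S.disjoint l g 1 ⟨S.Φ g S.base, ⟨_, hb, rfl⟩, by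
      change _ ∈ S.Φ (1 : G) '' S.W l
      rwa [h1]⟩
    exact Eq.trans this h1

/-- The group chain `G = G_0 ⊇ G_1 ⊇ ⋯` of the section at its base point. -/
def chain : GroupChain G where
  sub := S.stab
  sub_zero := by
    refine eq_top_iff.2 fun g _ => ?_
    rw [mem_stab_iff]
    exact (S.Φ g S.base).2
  anti := fun k l hkl g hg => by
    rw [mem_stab_iff] at hg ⊢
    exact S.anti hkl hg
  finiteIndex l := by
    have hf : Finite (Set.range fun g : G => S.Φ g '' S.W l) := (S.finite l).to_subtype
    have : Finite (G ⧸ S.stab l) := by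
      refine Finite.of_injective
        (Quotient.lift (s := QuotientGroup.leftRel (S.stab l))
          (fun g : G => (⟨S.Φ g '' S.W l, g, rfl⟩ : Set.range fun g : G => S.Φ g '' S.W l)) ?_) ?_
      · intro a b hab
        have hab' : a⁻¹ * b ∈ S.stab l := QuotientGroup.leftRel_apply.1 hab
        have h : S.Φ (a⁻¹ * b) '' S.W l = S.W l := hab'
        refine Subtype.ext ?_
        change S.Φ a '' S.W l = S.Φ b '' S.W l
        conv_lhs => rw [← h, ← image_mul, mul_inv_cancel_left]
      · rintro ⟨a⟩ ⟨b⟩ hab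
        have h : S.Φ a '' S.W l = S.Φ b '' S.W l := congrArg Subtype.val hab
        refine Quotient.sound (QuotientGroup.leftRel_apply.2 ?_)
        change S.Φ (a⁻¹ * b) '' S.W l = S.W l
        rw [image_mul, ← h, ← image_mul, inv_mul_cancel, map_one]
        exact Set.image_id _
    exact Subgroup.finiteIndex_of_finite_quotient

end TransverseSection

/-! ## Homotopy classes of paths from a base point -/

/-- The homotopy classes (relative to end points) of paths in `X` with initial point `x`. -/
abbrev PathsFrom {X : Type*} [TopologicalSpace X] (x : X) : Type _ :=
  Σ y, Path.Homotopic.Quotient x y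

namespace PathsFrom

variable {X E : Type*} [TopologicalSpace X] [TopologicalSpace E]

/-- Precomposition of a path class with a class of loops at the base point. -/
def act {x : X} (h : FundamentalGroup X x) (a : PathsFrom x) : PathsFrom x :=
  ⟨a.1, Path.Homotopic.Quotient.trans h a.2⟩

theorem act_one {x : X} (a : PathsFrom x) : act 1 a = a := by
  obtain ⟨y, c⟩ := a
  exact congrArg (Sigma.mk y) (Path.Homotopic.Quotient.refl_trans c)

theorem act_act {x : X} (g h : FundamentalGroup X x) (a : PathsFrom x) :
    act g (act h a) = act (h * g) a := by
  obtain ⟨y, c⟩ := a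
  exact congrArg (Sigma.mk y) (Path.Homotopic.Quotient.trans_assoc _ _ c).symm

/-- The image of a path class under a continuous map. -/
def map (f : C(E, X)) {e : E} {x : X} (h : f e = x) (a : PathsFrom e) : PathsFrom x :=
  ⟨f a.1, (a.2.map f).cast h.symm rfl⟩

theorem map_act (f : C(E, X)) {e : E} {x : X} (h : f e = x) (η : FundamentalGroup E e)
    (a : PathsFrom e) :
    map f h (act η a) = act (FundamentalGroup.mapOfEq f h η) (map f h a) := by
  subst h
  obtain ⟨y, c⟩ := a
  rw [FundamentalGroup.mapOfEq_apply]
  refine congrArg (Sigma.mk (f y)) ?_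
  obtain ⟨η⟩ := η
  obtain ⟨c⟩ := c
  refine congrArg Path.Homotopic.Quotient.mk ?_
  exact Path.map_trans _ _ f.continuous

theorem map_comp {Y : Type*} [TopologicalSpace Y] (f : C(E, X)) (g : C(X, Y)) {e : E} {x : X}
    {y : Y} (h : f e = x) (h' : g x = y) (h'' : (g.comp f) e = y) (a : PathsFrom e) :
    map (g.comp f) h'' a = map g h' (map f h a) := by
  subst h
  subst h'
  obtain ⟨z, c⟩ := a
  induction c using Path.Homotopic.Quotient.ind with | mk c =>
  rfl

theorem map_bijective (f : C(E, X)) (hf : IsCoveringMap f) {e : E} {x : X} (h : f e = x) :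
    Function.Bijective (map f h) := by
  subst h
  constructor
  · rintro ⟨y, c⟩ ⟨y', c'⟩ heq
    let F : PathsFrom (f e) → E := fun a => (hf.monodromy a.2 ⟨e, rfl⟩ : E)
    have hF : ∀ (z : E) (d : Path.Homotopic.Quotient e z), F (map f rfl ⟨z, d⟩) = z := by
      intro z d
      have := congrArg Subtype.val (hf.monodromy_map d)
      have h3 : F (map f rfl ⟨z, d⟩) =
        (hf.monodromy ((d.map f).cast rfl rfl) ⟨e, rfl⟩ : E) := rfl
      rw [h3, Path.Homotopic.Quotient.cast_rfl_rfl]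
      exact this
    have hy : y = y' := by rw [← hF y c, ← hF y' c', heq]
    subst hy
    have h2 := eq_of_heq (Sigma.mk.inj heq).2
    rw [Path.Homotopic.Quotient.cast_rfl_rfl, Path.Homotopic.Quotient.cast_rfl_rfl] at h2
    exact congrArg (Sigma.mk y) (hf.injective_path_homotopic_map e y h2)
  · rintro ⟨y, c⟩
    refine ⟨⟨_, hf.liftPathQuotient c ⟨e, rfl⟩⟩, ?_⟩
    have h1 := hf.map_liftPathQuotient c ⟨e, rfl⟩
    have h2 : f (hf.monodromy c ⟨e, rfl⟩) = y := (hf.monodromy c ⟨e, rfl⟩).2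
    refine Sigma.ext h2 ?_
    change HEq (((hf.liftPathQuotient c ⟨e, rfl⟩).map f).cast rfl rfl) c
    rw [Path.Homotopic.Quotient.cast_rfl_rfl]
    exact (heq_of_eq h1).trans (Path.Homotopic.Quotient.cast_heq _ _)

end PathsFrom

/-- Two classes of paths from `x` are identified when they differ by precomposition with an element
of `H`. -/
def coverSetoid {X : Type*} [TopologicalSpace X] (x : X) (H : Subgroup (FundamentalGroup X x)) :
    Setoid (PathsFrom x) where
  r a b := ∃ h ∈ H, b = PathsFrom.act h a
  iseqv :=
    { refl := fun a => ⟨1, H.one_mem, (PathsFrom.act_one a).symm⟩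
      symm := by
        rintro a _ ⟨h, hh, rfl⟩
        refine ⟨h⁻¹, H.inv_mem hh, ?_⟩
        rw [PathsFrom.act_act, mul_inv_cancel, PathsFrom.act_one]
      trans := by
        rintro a _ _ ⟨h, hh, rfl⟩ ⟨g, hg, rfl⟩
        exact ⟨h * g, H.mul_mem hh hg, PathsFrom.act_act _ _ _⟩ }

/-- The covering space of `X` associated to a subgroup `H` of `π₁(X, x)`: the space of classes of
paths from `x`, modulo precomposition with elements of `H`. -/
def AssociatedCover {X : Type*} [TopologicalSpace X] (x : X)
    (H : Subgroup (FundamentalGroup X x)) : Type _ :=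
  Quotient (coverSetoid x H)

/-- The topology on the associated covering space is the quotient topology of the compact-open
topology on the space of paths from `x`. -/
instance {X : Type*} [TopologicalSpace X] (x : X) (H : Subgroup (FundamentalGroup X x)) :
    TopologicalSpace (AssociatedCover x H) :=
  TopologicalSpace.coinduced
    (fun c : {c : C(unitInterval, X) // c 0 = x} =>
      (Quotient.mk (coverSetoid x H)
        ⟨c.1 1, Path.Homotopic.Quotient.mk ⟨c.1, c.2, rfl⟩⟩ : AssociatedCover x H))
    inferInstance

/-- The projection of the associated covering spaces induced by an inclusion of subgroups. -/
def AssociatedCover.project {X : Type*} [TopologicalSpace X] {x : X}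
    {H H' : Subgroup (FundamentalGroup X x)} (hle : H ≤ H') :
    AssociatedCover x H → AssociatedCover x H' :=
  Quotient.map' id fun _ _ ⟨h, hh, e⟩ => ⟨h, hle hh, e⟩

/-! ## Weak solenoids and their Molino spaces -/

/-- A presentation of a weak solenoid: a sequence of covering maps of degree greater than one
between closed connected `n`-manifolds. -/
structure Presentation (n : ℕ) where
  M : ℕ → Type u
  [top : ∀ l, TopologicalSpace (M l)]
  [t2 : ∀ l, T2Space (M l)]
  [compact : ∀ l, CompactSpace (M l)]
  [connected : ∀ l, ConnectedSpace (M l)]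
  [manifold : ∀ l, ChartedSpace (EuclideanSpace ℝ (Fin n)) (M l)]
  p : ∀ l, C(M (l + 1), M l)
  isCoveringMap : ∀ l, IsCoveringMap (p l)
  one_lt_degree : ∀ l y, 1 < (p l ⁻¹' {y}).ncard

attribute [instance] Presentation.top Presentation.t2 Presentation.compact Presentation.connected
  Presentation.manifold

namespace Presentation

variable {n : ℕ} (P : Presentation.{u} n)

/-- The weak solenoid: the inverse limit of the presentation. -/
def Solenoid : Type u := {s : ∀ l, P.M l // ∀ l, P.p l (s (l + 1)) = s l}

instance : TopologicalSpace P.Solenoid := instTopologicalSpaceSubtype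

/-- The projection of the solenoid to the base manifold. -/
def toBase : C(P.Solenoid, P.M 0) :=
  ⟨fun s => s.1 0, (continuous_apply 0).comp continuous_subtype_val⟩

/-- The covering map `q_l : M_l → M_0`. -/
def q : ∀ l, C(P.M l, P.M 0)
  | 0 => ContinuousMap.id _
  | l + 1 => (q l).comp (P.p l)

variable (s : P.Solenoid)

theorem q_apply : ∀ l, P.q l (s.1 l) = s.1 0
  | 0 => rfl
  | l + 1 => by
    change P.q l (P.p l (s.1 (l + 1))) = s.1 0
    rw [s.2 l]
    exact q_apply l

/-- The group chain of the presentation at the base point `s`: the image of `π₁(M_l, s_l)` in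
`π₁(M_0, s_0)`. -/
def imageGroup (l : ℕ) : Subgroup (FundamentalGroup (P.M 0) (s.1 0)) :=
  (FundamentalGroup.mapOfEq (P.q l) (P.q_apply s l)).range

/-- The core of `imageGroup l` in `π₁(M_0, s_0)`. -/
def coreGroup (l : ℕ) : Subgroup (FundamentalGroup (P.M 0) (s.1 0)) := (P.imageGroup s l).normalCore

/-- The push-forward of paths in `M_l` from `s_l` to paths in `M_0` from `s_0`. -/
def push (l : ℕ) : PathsFrom (s.1 l) → PathsFrom (s.1 0) := PathsFrom.map (P.q l) (P.q_apply s l)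

theorem push_succ (l : ℕ) (a : PathsFrom (s.1 (l + 1))) :
    P.push s (l + 1) a = P.push s l (PathsFrom.map (P.p l) (s.2 l) a) :=
  PathsFrom.map_comp (P.p l) (P.q l) (s.2 l) (P.q_apply s l) (P.q_apply s (l + 1)) a

theorem push_bijective (l : ℕ) : Function.Bijective (P.push s l) := by
  induction l with
  | zero =>
    have : P.push s 0 = id := by
      funext ⟨y, c⟩
      induction c using Path.Homotopic.Quotient.ind with | mk c =>
      rfl
    rw [this]
    exact Function.bijective_id
  | succ l ih =>
    have : P.push s (l + 1) = P.push s l ∘ PathsFrom.map (P.p l) (s.2 l) :=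
      funext (P.push_succ s l)
    rw [this]
    exact ih.comp (PathsFrom.map_bijective _ (P.isCoveringMap l) _)

/-- The lift of path classes in `M_0` from `s_0` to path classes in `M_l` from `s_l`. -/
def lift (l : ℕ) (a : PathsFrom (s.1 0)) : PathsFrom (s.1 l) :=
  (Equiv.ofBijective _ (P.push_bijective s l)).symm a

theorem push_lift (l : ℕ) (a : PathsFrom (s.1 0)) : P.push s l (P.lift s l a) = a :=
  (Equiv.ofBijective _ (P.push_bijective s l)).apply_symm_apply a

theorem imageGroup_succ_le (l : ℕ) : P.imageGroup s (l + 1) ≤ P.imageGroup s l := by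
  rintro _ ⟨η, rfl⟩
  refine ⟨FundamentalGroup.mapOfEq (P.p l) (s.2 l) η, ?_⟩
  have h : (⟨_, FundamentalGroup.mapOfEq (P.q (l + 1)) (P.q_apply s (l + 1)) η⟩ :
      PathsFrom (s.1 0)) = ⟨_, FundamentalGroup.mapOfEq (P.q l) (P.q_apply s l)
        (FundamentalGroup.mapOfEq (P.p l) (s.2 l) η)⟩ := by
    have key : ∀ {X E : Type u} [TopologicalSpace X] [TopologicalSpace E] (f : C(E, X)) {e : E}
        {x : X} (h : f e = x) (η : FundamentalGroup E e),
        (⟨x, FundamentalGroup.mapOfEq f h η⟩ : PathsFrom x) = PathsFrom.map f h ⟨e, η⟩ := by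
      intro X E _ _ f e x h η
      subst h
      rw [FundamentalGroup.mapOfEq_apply]
      rfl
    rw [key, key, key]
    exact P.push_succ s l _
  exact (eq_of_heq (Sigma.mk.inj h).2).symm

theorem coreGroup_succ_le (l : ℕ) : P.coreGroup s (l + 1) ≤ P.coreGroup s l :=
  Subgroup.normalCore_mono (P.imageGroup_succ_le s l)

/-- The `l`-th stage `M̂_l` of the Molino tower: the covering space of `M_0` associated to the
core subgroup. -/
abbrev MolinoStage (l : ℕ) : Type u := AssociatedCover (s.1 0) (P.coreGroup s l)

/-- The Molino space: the inverse limit of the tower of the covering spaces `M̂_l`. -/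
def MolinoSpace : Type u :=
  {z : ∀ l, P.MolinoStage s l //
    ∀ l, AssociatedCover.project (P.coreGroup_succ_le s l) (z (l + 1)) = z l}

instance : TopologicalSpace (P.MolinoSpace s) := instTopologicalSpaceSubtype

/-- The covering map `M̂_l → M_l`: a path class in `M_0` from `s_0` is sent to the end point of its
lift to `M_l` with initial point `s_l`. -/
def stageMap (l : ℕ) : P.MolinoStage s l → P.M l :=
  Quotient.lift (fun a => (P.lift s l a).1) (by
    rintro a _ ⟨h, hh, rfl⟩
    obtain ⟨η, rfl⟩ := Subgroup.normalCore_le _ hh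
    have : P.lift s l (PathsFrom.act
        (FundamentalGroup.mapOfEq (P.q l) (P.q_apply s l) η) a) =
        PathsFrom.act η (P.lift s l a) := by
      apply (P.push_bijective s l).1
      rw [push_lift]
      refine Eq.trans ?_ (PathsFrom.map_act (P.q l) (P.q_apply s l) η _).symm
      exact congrArg _ (P.push_lift s l a).symm
    change (P.lift s l a).1 = (P.lift s l (PathsFrom.act _ a)).1
    rw [this]
    rfl)

theorem p_stageMap (l : ℕ) (z : P.MolinoStage s (l + 1)) :
    P.p l (P.stageMap s (l + 1) z) =
      P.stageMap s l (AssociatedCover.project (P.coreGroup_succ_le s l) z) := by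
  obtain ⟨a⟩ := z
  change (PathsFrom.map (P.p l) (s.2 l) (P.lift s (l + 1) a)).1 = (P.lift s l a).1
  refine congrArg Sigma.fst ((P.push_bijective s l).1 ?_)
  rw [← push_succ, push_lift, push_lift]

/-- The projection of the Molino sequence `𝒟 → Ŝ → S`, from the Molino space to the solenoid. -/
def molinoMap (z : P.MolinoSpace s) : P.Solenoid :=
  ⟨fun l => P.stageMap s l (z.1 l), fun l => by rw [p_stageMap, z.2 l]⟩

end Presentation

/-- A presentation of `M` adapted to a transverse section: a homeomorphism from `M` to the weak
solenoid which carries `V l` to the fibre of the projection to `M_l` through the base point, and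
an isomorphism of `G` with `π₁(M_0)` under which the action on `V 0` is the monodromy action: the
path in the solenoid that starts at (the image of) `v` and lifts a loop in the class of `g` ends at
(the image of) `g • v`. -/
structure TransverseSection.Realization {M : Type u} [MetricSpace M] {n : ℕ}
    {A : FoliatedAtlas M n} {G : Type*} [Group G] (S : TransverseSection A G)
    (P : Presentation.{u} n) where
  Θ : M ≃ₜ P.Solenoid
  image_V : ∀ l, (fun z => Θ (A.emb z)) '' S.V l =
    {s : P.Solenoid | s.1 l = (Θ (A.emb S.x)).1 l}
  e : G ≃* FundamentalGroup (P.M 0) ((Θ (A.emb S.x)).1 0)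
  monodromy : ∀ (g : G) (v : S.V 0),
    ∃ (c : Path (Θ (A.emb v)) (Θ (A.emb (S.Φ g v))))
      (h₀ : (Θ (A.emb S.x)).1 0 = P.toBase (Θ (A.emb v)))
      (h₁ : (Θ (A.emb S.x)).1 0 = P.toBase (Θ (A.emb (S.Φ g v)))),
      e g = Path.Homotopic.Quotient.mk ((c.map P.toBase.continuous).cast h₀ h₁)

end

/-! ## Inverse limits of finite sets and discriminants -/

/-! Suppose that the discriminant of the chain truncated at `k` is trivial. A compactness argument
for inverse systems of finite sets then gives, for each `l`, some `m` such that `G_m` lies in the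
core `E_{k,l}`. If `g` fixes a point `y` of `V_k`, then for every `m` an element of `G_k` carries
`V_m` onto the translate containing `y`, and conjugating `g` by it gives an element of `G_m`. By
normality `g` lies in all cores, so it preserves every `G_k`-translate of every `V_l`; as the mesh
tends to zero, `g` is the identity on `V_k`. After conjugation, any element of `G` is the identity
near each of its fixed points. Hence one element with a non-trivial germ at a fixed point makes all
truncated discriminants non-trivial (`nontrivial_discriminant`, `exists_not_truncate_le_core`).

Such an element is a conjugate of the given holonomy germ, provided that the leaf meets `V_0`. This
is minimality, and it follows from equicontinuity: the saturation of a clopen set is open, and it is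
closed because a point close to `z` can follow `z` along any chain of plaques without leaving the
domains of the holonomy maps (`Equicontinuous.isClosed_saturation`). Connectedness of `M` does the
rest.

For the Molino space, the discriminant acts freely on each fibre by prepending loops, level by level
(`nontrivial_molinoMap_fibre`). Fibres are non-empty by the same compactness argument, and the
realization identifies the two group chains (`e_mem_imageGroup_iff`). -/

/-- An inverse sequence of finite non-empty sets has a compatible sequence of elements. -/
theorem exists_compatible_sequence {X : ℕ → Type u} (f : ∀ l, X (l + 1) → X l)
    (F : ∀ l, Set (X l)) (hfin : ∀ l, (F l).Finite) (hne : ∀ l, (F l).Nonempty)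
    (hf : ∀ l, MapsTo (f l) (F (l + 1)) (F l)) :
    ∃ x : ∀ l, X l, (∀ l, x l ∈ F l) ∧ ∀ l, f l (x (l + 1)) = x l := by
  let D : CategoryTheory.Functor ℕᵒᵖ (Type u) :=
    CategoryTheory.Functor.ofOpSequence (X := fun l => (F l : Type u)) fun l =>
      TypeCat.ofHom fun x => (⟨f l x, hf l x.2⟩ : F l)
  have : ∀ j, Finite (D.obj j) := fun j => (hfin j.unop).to_subtype
  have : ∀ j, Nonempty (D.obj j) := fun j => (hne j.unop).to_subtype
  obtain ⟨x, hx⟩ := nonempty_sections_of_finite_inverse_system D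
  refine ⟨fun l => (x (Opposite.op l) : F l).1, fun l => (x (Opposite.op l) : F l).2, fun l => ?_⟩
  have h := hx (CategoryTheory.homOfLE (Nat.le_succ l)).op
  rw [CategoryTheory.Functor.ofOpSequence_map_homOfLE_succ] at h
  exact congrArg Subtype.val h

namespace GroupChain

variable {G : Type*} [Group G] (H : GroupChain G)

/-- If no group of the chain is contained in the core `C_k`, then some element of the discriminant
group has a non-trivial `k`-th entry. -/
theorem nontrivial_discriminant (k : ℕ) (hk : ∀ m, ¬ H.sub m ≤ H.core k) :
    Nontrivial H.discriminant := by
  obtain ⟨d, hd, hbond⟩ := exists_compatible_sequence (fun l => H.bond l)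
    -- The representatives avoid `C_k` at every level, so the limit sequence cannot have a trivial
    -- `k`-th entry.
    (fun l => (QuotientGroup.mk : G → G ⧸ H.core l) '' {g | g ∈ H.sub l ∧ g ∉ H.core k})
    (fun l => by
      have := H.finiteIndex l
      have : (H.core l).FiniteIndex := Subgroup.finiteIndex_normalCore _
      exact Set.toFinite _)
    (fun l => by
      obtain ⟨g, hg, hg'⟩ := SetLike.not_le_iff_exists.1 (hk l)
      exact ⟨_, g, ⟨hg, hg'⟩, rfl⟩)
    (fun l => by
      rintro _ ⟨g, ⟨hg, hg'⟩, rfl⟩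
      exact ⟨g, ⟨H.anti (Nat.le_succ l) hg, hg'⟩, rfl⟩)
  refine ⟨⟨⟨d, fun l => ?_, hbond⟩, 1, fun h => ?_⟩⟩
  · obtain ⟨g, ⟨hg, -⟩, h⟩ := hd l
    exact ⟨g, hg, h⟩
  · obtain ⟨g, ⟨-, hg⟩, hgk⟩ := hd k
    refine hg ((QuotientGroup.eq_one_iff g).1 (hgk.trans ?_))
    exact congrFun (congrArg Subtype.val h) k

end GroupChain

/-! ### Fixed points of the action and cores of the truncated chains -/

namespace FoliatedAtlas

variable {M : Type u} [TopologicalSpace M] {n : ℕ} (A : FoliatedAtlas M n)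

/-- Across charts this is the disjointness of the embedded transversals. It lets `transDist`
separate points. -/
theorem emb_injective : Function.Injective A.emb := by
  rintro ⟨i, a⟩ ⟨j, b⟩ h
  by_cases hij : i = j
  · subst hij
    have := (A.chart i).φ.symm.injective (Subtype.ext h)
    exact congrArg (Sigma.mk i) (Prod.mk.inj this).2
  · exact absurd h (A.disjoint i j hij a b)

end FoliatedAtlas

namespace TransverseSection

variable {M : Type u} [MetricSpace M] {n : ℕ} {A : FoliatedAtlas M n} {G : Type*} [Group G]
  (S : TransverseSection A G)

theorem Φ_mul_apply (g h : G) (v : S.V 0) : S.Φ (g * h) v = S.Φ g (S.Φ h v) := by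
  rw [map_mul]; rfl

theorem Φ_one_apply (v : S.V 0) : S.Φ 1 v = v := by
  rw [map_one]; rfl

theorem Φ_inv_apply_self (g : G) (v : S.V 0) : S.Φ g⁻¹ (S.Φ g v) = v := by
  rw [← Φ_mul_apply, inv_mul_cancel, Φ_one_apply]

theorem Φ_apply_inv_self (g : G) (v : S.V 0) : S.Φ g (S.Φ g⁻¹ v) = v := by
  rw [← Φ_mul_apply, mul_inv_cancel, Φ_one_apply]

theorem Φ_mem_of_mem_stab {l : ℕ} {g : G} (hg : g ∈ S.stab l) {v : S.V 0} (hv : v ∈ S.W l) :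
    S.Φ g v ∈ S.W l := by
  have h : S.Φ g '' S.W l = S.W l := hg
  rw [← h]
  exact ⟨v, hv, rfl⟩

/-- The translates of `V l` form a partition, so a translate that meets `V l` equals it. -/
theorem mem_stab_of_mem {l : ℕ} {g : G} {v : S.V 0} (hv : v ∈ S.W l) (hg : S.Φ g v ∈ S.W l) :
    g ∈ S.stab l := by
  have h1 : S.Φ (1 : G) '' S.W l = S.W l := by rw [map_one]; exact Set.image_id _
  have := S.disjoint l g 1 ⟨S.Φ g v, ⟨_, hv, rfl⟩, by
    change _ ∈ S.Φ (1 : G) '' S.W l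
    rwa [h1]⟩
  exact Eq.trans this h1

/-- Points that lie in a common translate of `V l` for all large `l` are equal. -/
theorem eq_of_mem_translates {v w : S.V 0}
    (h : ∀ N, ∃ l ≥ N, ∃ g : G, v ∈ S.Φ g '' S.W l ∧ w ∈ S.Φ g '' S.W l) : v = w := by
  have hd : A.transDist v w = 0 := by
    refine le_antisymm (le_of_forall_gt fun ε hε => ?_) bot_le
    obtain ⟨L, hL⟩ := S.mesh ε hε
    obtain ⟨l, hl, g, hv, hw⟩ := h L
    exact hL l hl g v hv w hw
  unfold FoliatedAtlas.transDist at hd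
  split_ifs at hd
  · exact Subtype.ext (A.emb_injective (edist_eq_zero.1 hd))
  · exact absurd hd ENNReal.top_ne_zero

/-- If `G_m` lies in the core of `G_l` relative to `G_k` for each `l` and some `m`, then an element
of `G_k` which fixes a point of `V k` fixes all points of `V k`. -/
theorem apply_eq_self_of_truncate_le_core (k : ℕ)
    (hk : ∀ l, ∃ m, (S.chain.truncate k).sub m ≤ (S.chain.truncate k).core l)
    {g : G} {y : S.V 0} (hy : y ∈ S.W k) (hg : S.Φ g y = y) {v : S.V 0} (hv : v ∈ S.W k) :
    S.Φ g v = v := by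
  have hW : ∀ l, S.W (k + l) ⊆ S.W k := fun l => Set.preimage_mono (S.anti (Nat.le_add_right k l))
  have hgk : g ∈ S.chain.sub k := S.mem_stab_of_mem hy (by rwa [hg])
  -- An element that carries a point of `V (k + l)`, hence of `V k`, to a point of `V k` stabilizes
  -- `V k`. So the `G_k`-translates of `V (k + l)` already cover `V k`.
  have hcover : ∀ (v : S.V 0), v ∈ S.W k → ∀ l, ∃ a ∈ S.chain.sub k, ∃ w ∈ S.W (k + l), S.Φ a w = v := by
    intro v hv l
    obtain ⟨a, w, hw, rfl⟩ := S.covers (k + l) v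
    exact ⟨a, S.mem_stab_of_mem (hW l hw) hv, w, hw, rfl⟩
  -- With `y = b w`, the conjugate `b⁻¹ g b` fixes `w`, so it lies in the `m`-th group and hence in
  -- the core; normality brings `g` back.
  have hcore : ∀ l, (⟨g, hgk⟩ : S.chain.sub k) ∈ (S.chain.truncate k).core l := by
    intro l
    obtain ⟨m, hm⟩ := hk l
    obtain ⟨b, hb, w, hw, rfl⟩ := hcover y hy m
    have h1 : (⟨b, hb⟩⁻¹ * ⟨g, hgk⟩ * ⟨b, hb⟩ : S.chain.sub k) ∈ (S.chain.truncate k).sub m := by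
      refine Subgroup.mem_subgroupOf.2 (S.mem_stab_of_mem hw ?_)
      change S.Φ (b⁻¹ * g * b) w ∈ _
      rwa [Φ_mul_apply, Φ_mul_apply, hg, Φ_inv_apply_self]
    have h2 := (GroupChain.core_normal (S.chain.truncate k) l).conj_mem _ (hm h1) ⟨b, hb⟩
    rwa [mul_assoc, mul_assoc, mul_inv_cancel, mul_one, mul_inv_cancel_left] at h2
  -- Lying in the cores, `g` preserves the small translate `a V (k + N)` around `v`, so `v` and `g
  -- v` are arbitrarily close.
  refine S.eq_of_mem_translates fun N => ⟨k + N, Nat.le_add_left N k, ?_⟩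
  obtain ⟨a, ha, w, hw, rfl⟩ := hcover v hv N
  refine ⟨a, ⟨S.Φ (a⁻¹ * g * a) w, S.Φ_mem_of_mem_stab ?_ hw, ?_⟩, w, hw, rfl⟩
  · have h2 := (GroupChain.core_normal (S.chain.truncate k) N).conj_mem _ (hcore N) ⟨a, ha⟩⁻¹
    have h3 := Subgroup.mem_subgroupOf.1 (Subgroup.normalCore_le _ h2)
    rwa [inv_inv] at h3
  · rw [← Φ_mul_apply, ← Φ_mul_apply]
    congr 2
    group

/-- If some element of `G` fixes a point but is not the identity near it, then no group of a
truncated chain is contained in all of its cores. -/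
theorem exists_not_truncate_le_core {g : G} {y : S.V 0} (hg : S.Φ g y = y)
    (hgerm : ¬ (S.Φ g : S.V 0 → S.V 0) =ᶠ[𝓝 y] id) (k : ℕ) :
    ∃ l, ∀ m, ¬ (S.chain.truncate k).sub m ≤ (S.chain.truncate k).core l := by
  by_contra! hk
  obtain ⟨a, w, hw, rfl⟩ := S.covers k y
  refine hgerm ?_
  -- The conjugate by `a` fixes a point of `V k`, hence all of `V k`; so `g` is the identity on this
  -- neighbourhood of `y`.
  have hopen : IsOpen (S.Φ a '' S.W k) :=
    (S.Φ a).isOpenMap _ ((S.isClopen k).isOpen.preimage continuous_subtype_val)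
  filter_upwards [hopen.mem_nhds ⟨w, hw, rfl⟩]
  rintro _ ⟨v, hv, rfl⟩
  have h1 : S.Φ (a⁻¹ * g * a) w = w := by
    rw [Φ_mul_apply, Φ_mul_apply, hg, Φ_inv_apply_self]
  have h2 := S.apply_eq_self_of_truncate_le_core k hk hw h1 hv
  rw [Φ_mul_apply, Φ_mul_apply] at h2
  have h3 := congrArg (S.Φ a) h2
  rwa [Φ_apply_inv_self] at h3

end TransverseSection

/-! ## Chains of plaques in a shrinking of the atlas -/

namespace FoliatedAtlas

section Top

variable {M : Type u} [TopologicalSpace M] {n : ℕ} (A : FoliatedAtlas M n)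

theorem emb_mem_U (z : A.Trans) : A.emb z ∈ (A.chart z.1).U :=
  ⟨(A.chart z.1).φ.symm (ClosedCube.center n, z.2), fun k => by
    rw [Homeomorph.apply_symm_apply]
    simp [ClosedCube.center], rfl⟩

theorem proj_emb (z : A.Trans) : A.proj z.1 ⟨A.emb z, A.emb_mem_U z⟩ = z := by
  refine Sigma.ext rfl (heq_of_eq ?_)
  change ((A.chart z.1).φ ((A.chart z.1).φ.symm (ClosedCube.center n, z.2))).2 = z.2
  rw [Homeomorph.apply_symm_apply]

theorem continuous_proj (i : Fin A.ν) : Continuous (A.proj i) := by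
  refine continuous_sigmaMk.comp (continuous_snd.comp ((A.chart i).φ.continuous.comp ?_))
  exact Continuous.subtype_mk continuous_subtype_val _

theorem proj_eq_proj {i j : Fin A.ν} {p q : M} (hpi : p ∈ (A.chart i).U) (hqi : q ∈ (A.chart i).U)
    (hpj : p ∈ (A.chart j).U) (hqj : q ∈ (A.chart j).U)
    (h : A.proj i ⟨p, hpi⟩ = A.proj i ⟨q, hqi⟩) : A.proj j ⟨p, hpj⟩ = A.proj j ⟨q, hqj⟩ :=
  congrArg (Sigma.mk j) (A.regular i j p q hpi hpj hqi hqj (eq_of_heq (Sigma.mk.inj h).2))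

theorem hol_proj {i j : Fin A.ν} {p : M} (hi : p ∈ (A.chart i).U) (hj : p ∈ (A.chart j).U) :
    A.proj i ⟨p, hi⟩ ∈ (A.hol i j).source ∧ A.hol i j (A.proj i ⟨p, hi⟩) = A.proj j ⟨p, hj⟩ := by
  have h : A.HolRel i j (A.proj i ⟨p, hi⟩) (A.proj j ⟨p, hj⟩) := ⟨p, hi, hj, rfl, rfl⟩
  exact ⟨⟨_, h⟩, HolRel.holFun_eq A h⟩

variable (v : Fin A.ν → Set M)

/-- Two points are joined by a plaque of the `i`-th chart, for some `i` such that both points lie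
in `v i`. -/
def Linked (p q : M) : Prop :=
  ∃ (i : Fin A.ν) (hp : p ∈ (A.chart i).U) (hq : q ∈ (A.chart i).U),
    p ∈ v i ∧ q ∈ v i ∧ A.proj i ⟨p, hp⟩ = A.proj i ⟨q, hq⟩

/-- Two points are joined by a finite chain of linked points. -/
def Chained : M → M → Prop := Relation.ReflTransGen (A.Linked v)

variable {A v}

theorem Chained.symm {p q : M} (h : A.Chained v p q) : A.Chained v q p := by
  have : Std.Symm (A.Linked v) := ⟨fun p q ⟨i, hp, hq, h1, h2, h3⟩ => ⟨i, hq, hp, h2, h1, h3.symm⟩⟩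
  exact Relation.ReflTransGen.stdSymm.symm _ _ h

theorem Chained.trans {p q r : M} (h : A.Chained v p q) (h' : A.Chained v q r) :
    A.Chained v p r :=
  Relation.ReflTransGen.trans h h'

/-- Points of a common plaque are chained. -/
theorem chained_of_proj_eq (hopen : ∀ i, IsOpen (v i)) (hcover : ⋃ i, v i = univ)
    (hsub : ∀ i, v i ⊆ (A.chart i).U) {i : Fin A.ν} {p q : M} (hp : p ∈ (A.chart i).U)
    (hq : q ∈ (A.chart i).U) (h : A.proj i ⟨p, hp⟩ = A.proj i ⟨q, hq⟩) : A.Chained v p q := by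
  obtain ⟨p, hp', rfl⟩ := id hp
  obtain ⟨q, hq', rfl⟩ := id hq
  let C := A.chart i
  -- A plaque is parametrized by the open cube: it is connected, and its image stays in the chart
  -- domain.
  let I : Set (Fin n → ℝ) := Set.univ.pi fun _ => Set.Ioo (-1 : ℝ) 1
  have hI : PreconnectedSpace I :=
    isPreconnected_iff_preconnectedSpace.1
      (convex_pi fun _ _ => convex_Ioo (-1 : ℝ) 1).isPreconnected
  have hIK : ∀ c : I, (c : Fin n → ℝ) ∈ Set.Icc (-1 : Fin n → ℝ) 1 := fun c =>
    ⟨fun k => (c.2 k trivial).1.le, fun k => (c.2 k trivial).2.le⟩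
  let t : C.T := (C.φ p).2
  let F : I → M := fun c => (C.φ.symm (⟨c, hIK c⟩, t) : C.K)
  have hF : Continuous F := by
    refine continuous_subtype_val.comp (C.φ.symm.continuous.comp ?_)
    exact (Continuous.subtype_mk continuous_subtype_val _).prodMk continuous_const
  have hFU : ∀ c, F c ∈ C.U := fun c => ⟨_, fun k => by
    rw [Homeomorph.apply_symm_apply]
    exact c.2 k trivial, rfl⟩
  have hFt : ∀ c, A.proj i ⟨F c, hFU c⟩ = ⟨i, t⟩ := fun c => by
    refine congrArg (Sigma.mk i) ?_
    change (C.φ (C.φ.symm (⟨c, hIK c⟩, t))).2 = t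
    rw [Homeomorph.apply_symm_apply]
  have hq2 : (C.φ q).2 = t := (eq_of_heq (Sigma.mk.inj h).2).symm
  let a : I := ⟨(C.φ p).1, fun k _ => hp' k⟩
  let b : I := ⟨(C.φ q).1, fun k _ => hq' k⟩
  have ha : F a = p := congrArg Subtype.val (C.φ.symm_apply_apply p)
  have hb : F b = q := by
    change ((C.φ.symm ((C.φ q).1, t) : C.K) : M) = q
    rw [← hq2]
    exact congrArg Subtype.val (C.φ.symm_apply_apply q)
  -- Nearby points of the plaque lie in a common `v j`, and by regularity on a common plaque of the
  -- `j`-th chart, so one link joins them. The chain classes are therefore open, hence clopen, in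
  -- the plaque.
  have hnear : ∀ c, ∀ᶠ d in 𝓝 c, A.Chained v (F c) (F d) := by
    intro c
    obtain ⟨j, hj⟩ := mem_iUnion.1 (hcover.ge (mem_univ (F c)))
    filter_upwards [((hopen j).preimage hF).mem_nhds hj] with d hd
    exact Relation.ReflTransGen.single ⟨j, hsub j hj, hsub j hd, hj, hd,
      A.proj_eq_proj (hFU c) (hFU d) _ _ ((hFt c).trans (hFt d).symm)⟩
  have hclopen : IsClopen {c | A.Chained v (F a) (F c)} := by
    constructor
    · refine isOpen_compl_iff.1 (isOpen_iff_mem_nhds.2 fun c hc => ?_)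
      filter_upwards [hnear c] with d hd hd'
      exact hc (hd'.trans hd.symm)
    · refine isOpen_iff_mem_nhds.2 fun c hc => ?_
      filter_upwards [hnear c] with d hd
      exact hc.trans hd
  have := (hclopen.eq_univ ⟨a, Relation.ReflTransGen.refl⟩).ge (mem_univ b)
  rwa [← ha, ← hb]

/-- Holonomy maps do not change the class of chained points. -/
theorem chained_of_pseudoStarGroup (hopen : ∀ i, IsOpen (v i)) (hcover : ⋃ i, v i = univ)
    (hsub : ∀ i, v i ⊆ (A.chart i).U) {γ : OpenPartialHomeomorph A.Trans A.Trans}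
    (hγ : A.PseudoStarGroup γ) {z : A.Trans} (hz : z ∈ γ.source) :
    A.Chained v (A.emb z) (A.emb (γ z)) := by
  induction hγ generalizing z with
  | hol i j =>
    obtain ⟨w, h⟩ := hz
    have hw : A.hol i j z = w := HolRel.holFun_eq A h
    rw [hw]
    obtain ⟨p, hi, hj, rfl, rfl⟩ := h
    -- The common point `p` of the two plaques is joined to the centre of each.
    exact (chained_of_proj_eq hopen hcover hsub (A.emb_mem_U _) hi (A.proj_emb _)).trans
      (chained_of_proj_eq hopen hcover hsub hj (A.emb_mem_U (A.proj j ⟨p, hj⟩))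
        (A.proj_emb _).symm)
  | comp hf hg ihf ihg =>
    rw [OpenPartialHomeomorph.trans_source] at hz
    exact (ihf hz.1).trans (ihg hz.2)
  | @symm f hf ih =>
    have h := ih (f.map_target hz)
    rw [f.right_inv hz] at h
    exact h.symm
  | restr s hs hf ih => exact ih hz.1

/-- The points of the transverse space which some holonomy map takes to `V`. -/
def saturation (A : FoliatedAtlas M n) (V : Set A.Trans) : Set A.Trans :=
  {z | ∃ γ, A.PseudoStarGroup γ ∧ z ∈ γ.source ∧ γ z ∈ V}

theorem isOpen_saturation {V : Set A.Trans} (hV : IsOpen V) : IsOpen (A.saturation V) := by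
  refine isOpen_iff_mem_nhds.2 ?_
  rintro z ⟨γ, hγ, hz, hzV⟩
  filter_upwards [γ.open_source.mem_nhds hz, (γ.continuousAt hz).preimage_mem_nhds
    (hV.mem_nhds hzV)] with w hw hwV
  exact ⟨γ, hγ, hw, hwV⟩

theorem mem_saturation_of_apply_mem {V : Set A.Trans} {γ : OpenPartialHomeomorph A.Trans A.Trans}
    (hγ : A.PseudoStarGroup γ) {z : A.Trans} (hz : z ∈ γ.source) (h : γ z ∈ A.saturation V) :
    z ∈ A.saturation V := by
  obtain ⟨η, hη, hz', hV⟩ := h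
  exact ⟨γ.trans η, .comp hγ hη, by rw [OpenPartialHomeomorph.trans_source]; exact ⟨hz, hz'⟩, hV⟩

/-- A non-empty clopen saturation is everything, if the space is connected. -/
theorem saturation_eq_univ [PreconnectedSpace M] {V : Set A.Trans} (hV : V.Nonempty)
    (ho : IsOpen (A.saturation V)) (hc : IsOpen (A.saturation V)ᶜ) : A.saturation V = univ := by
  have key : ∀ B : Set A.Trans, IsOpen B →
      IsOpen {p | ∃ (i : Fin A.ν) (hp : p ∈ (A.chart i).U), A.proj i ⟨p, hp⟩ ∈ B} := by
    intro B hB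
    have : {p | ∃ (i : Fin A.ν) (hp : p ∈ (A.chart i).U), A.proj i ⟨p, hp⟩ ∈ B} =
        ⋃ i, (↑) '' (A.proj i ⁻¹' B) := by
      ext p
      simp
    rw [this]
    exact isOpen_iUnion fun i => (A.chart i).isOpen_U.isOpenMap_subtype_val _
      (hB.preimage (A.continuous_proj i))
  -- Whether the plaque through `p` lies in the saturation does not depend on the chart, since
  -- `h_{i,j}` relates the two plaques.
  have hdisj : ∀ {p : M} {i j : Fin A.ν} (hi : p ∈ (A.chart i).U) (hj : p ∈ (A.chart j).U),
      A.proj j ⟨p, hj⟩ ∈ A.saturation V → A.proj i ⟨p, hi⟩ ∈ A.saturation V := by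
    intro p i j hi hj h
    obtain ⟨h1, h2⟩ := A.hol_proj hi hj
    exact mem_saturation_of_apply_mem (.hol i j) h1 (by rwa [h2])
  have hclopen : IsClopen {p | ∃ (i : Fin A.ν) (hp : p ∈ (A.chart i).U),
      A.proj i ⟨p, hp⟩ ∈ A.saturation V} := by
    refine ⟨isOpen_compl_iff.1 ?_, key _ ho⟩
    convert key _ hc using 1
    ext p
    constructor
    · intro h
      obtain ⟨i, hi⟩ := mem_iUnion.1 (A.cover.ge (mem_univ p))
      exact ⟨i, hi, fun h' => h ⟨i, hi, h'⟩⟩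
    · rintro ⟨i, hi, h⟩ ⟨j, hj, h'⟩
      exact h (hdisj hi hj h')
  obtain ⟨x, hx⟩ := hV
  -- The pseudo⋆group contains no global identity by definition; `h_{i,i}` serves as the identity
  -- near `x`.
  have hx' : x ∈ A.saturation V := by
    obtain ⟨h1, h2⟩ := A.hol_proj (A.emb_mem_U x) (A.emb_mem_U x)
    rw [A.proj_emb] at h1 h2
    exact ⟨_, .hol x.1 x.1, h1, by rwa [h2]⟩
  have huniv := hclopen.eq_univ ⟨A.emb x, x.1, A.emb_mem_U x, by rwa [A.proj_emb]⟩
  refine eq_univ_of_forall fun z => ?_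
  obtain ⟨j, hj, h⟩ := huniv.ge (mem_univ (A.emb z))
  have := hdisj (A.emb_mem_U z) hj h
  rwa [A.proj_emb] at this

end Top

/-! ### Equicontinuity implies minimality -/

section Metric

variable {M : Type u} [MetricSpace M] {n : ℕ} {A : FoliatedAtlas M n}

theorem transDist_of_fst_eq {z w : A.Trans} (h : z.1 = w.1) :
    A.transDist z w = edist (A.emb z) (A.emb w) := if_pos h

theorem transDist_comm (z w : A.Trans) : A.transDist z w = A.transDist w z := by
  unfold transDist
  simp only [edist_comm, eq_comm]

theorem continuous_emb (A : FoliatedAtlas M n) : Continuous A.emb := by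
  refine continuous_sigma fun i => ?_
  exact continuous_subtype_val.comp ((A.chart i).φ.symm.continuous.comp
    (continuous_const.prodMk continuous_id))

/-- The chart index is locally constant, so the value `∞` does not occur near `z`, and the embedding
is continuous. -/
theorem eventually_transDist_lt (z : A.Trans) {δ : ENNReal} (hδ : 0 < δ) :
    ∀ᶠ w in 𝓝 z, A.transDist z w < δ := by
  have h1 : IsOpen {w : A.Trans | w.1 = z.1} :=
    (isOpen_discrete {z.1}).preimage (f := Sigma.fst) (continuous_sigma fun i => continuous_const)
  filter_upwards [h1.mem_nhds rfl, A.continuous_emb.continuousAt.preimage_mem_nhds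
    (Metric.eball_mem_nhds (A.emb z) hδ)] with w hw hw'
  rw [transDist_of_fst_eq hw.symm, edist_comm]
  exact hw'

variable [CompactSpace M]

theorem compactSpace_T (A : FoliatedAtlas M n) (i : Fin A.ν) : CompactSpace (A.chart i).T := by
  have : CompactSpace (A.chart i).K := isCompact_iff_compactSpace.1 (A.chart i).isClosed_K.isCompact
  have : CompactSpace (ClosedCube n × (A.chart i).T) := (A.chart i).φ.compactSpace
  have : Nonempty (ClosedCube n) := ⟨ClosedCube.center n⟩
  refine ⟨?_⟩
  convert isCompact_univ.image (f := (Prod.snd : ClosedCube n × (A.chart i).T → _)) continuous_snd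
  rw [image_univ, Prod.range_snd]

instance compactSpace_trans (A : FoliatedAtlas M n) : CompactSpace A.Trans := by
  have := A.compactSpace_T
  infer_instance

/-- A neighbourhood of a compact subset of the transverse space is a uniform neighbourhood. -/
theorem exists_uniform_nhds {D O : Set A.Trans} (hD : IsCompact D) (hO : IsOpen O) (h : D ⊆ O) :
    ∃ ε > 0, ∀ z ∈ D, ∀ w, A.transDist z w < ε → w ∈ O := by
  -- The images of `D` and of the complement of `O` are disjoint compact sets in `M`, hence at
  -- positive distance.
  have hdisj : Disjoint (A.emb '' D) (A.emb '' Oᶜ) :=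
    (disjoint_image_iff A.emb_injective).2 (disjoint_compl_right_iff_subset.2 h)
  obtain ⟨δ, hδ, hd⟩ := hdisj.exists_thickenings (hD.image A.continuous_emb)
    (hO.isClosed_compl.isCompact.image A.continuous_emb).isClosed
  refine ⟨ENNReal.ofReal δ, ENNReal.ofReal_pos.2 hδ, fun z hz w hzw => ?_⟩
  by_contra hw
  refine Set.disjoint_left.1 hd ?_ (Metric.self_subset_thickening hδ _ ⟨w, hw, rfl⟩)
  refine Metric.mem_thickening_iff_exists_edist_lt _ _ |>.2 ⟨A.emb z, ⟨z, hz, rfl⟩, ?_⟩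
  rw [edist_comm]
  unfold transDist at hzw
  split_ifs at hzw
  · exact hzw
  · exact absurd hzw not_top_lt

/-- The local defining map takes a closed subset of the chart domain to a compact set. -/
theorem isCompact_proj_image (i : Fin A.ν) {s : Set M} (hs : IsClosed s)
    (hsi : s ⊆ (A.chart i).U) : IsCompact (A.proj i '' ((↑) ⁻¹' s)) := by
  refine IsCompact.image ?_ (A.continuous_proj i)
  refine Subtype.isCompact_iff.2 ?_
  rw [Subtype.image_preimage_coe, inter_eq_right.2 hsi]
  exact hs.isCompact

/-- The atlas has a shrinking that still contains the embedded transversals. -/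
theorem exists_shrinking (A : FoliatedAtlas M n) : ∃ v : Fin A.ν → Set M, (∀ i, IsOpen (v i)) ∧
    ⋃ i, v i = univ ∧ (∀ i, closure (v i) ⊆ (A.chart i).U) ∧ ∀ z : A.Trans, A.emb z ∈ v z.1 := by
  obtain ⟨v, hv, hvo, hvU⟩ := exists_iUnion_eq_closure_subset (fun i => (A.chart i).isOpen_U)
    (fun _ => Set.toFinite _) A.cover
  -- The embedded transversal of each chart is compact, so a neighbourhood of it can be added to the
  -- shrinking. Chains of plaques then start and end in the shrunken domain of the right chart.
  have h : ∀ i, ∃ u, IsOpen u ∧ range (fun t => A.emb ⟨i, t⟩) ⊆ u ∧ closure u ⊆ (A.chart i).U := by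
    intro i
    have := A.compactSpace_T i
    exact normal_exists_closure_subset
      (isCompact_range (A.continuous_emb.comp continuous_sigmaMk)).isClosed (A.chart i).isOpen_U
      (range_subset_iff.2 fun t => A.emb_mem_U ⟨i, t⟩)
  choose u huo hu huU using h
  refine ⟨fun i => v i ∪ u i, fun i => (hvo i).union (huo i), ?_, fun i => ?_, fun z => ?_⟩
  · exact univ_subset_iff.1 (hv.ge.trans (iUnion_mono fun i => subset_union_left))
  · rw [closure_union]
    exact union_subset (hvU i) (huU i)
  · exact Or.inr (hu z.1 ⟨z.2, rfl⟩)

/-- A clopen set of the transverse space has a clopen saturation, if the holonomy pseudo⋆group is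
equicontinuous. -/
theorem Equicontinuous.isClosed_saturation (hA : A.Equicontinuous) {V : Set A.Trans}
    (hV : IsClopen V) : IsClosed (A.saturation V) := by
  obtain ⟨v, hvo, hvc, hvU, hvemb⟩ := A.exists_shrinking
  have hsub : ∀ i, v i ⊆ (A.chart i).U := fun i => subset_closure.trans (hvU i)
  obtain ⟨ε₀, hε₀, hεV⟩ := exists_uniform_nhds hV.isClosed.isCompact hV.isOpen subset_rfl
  -- A Lebesgue number: passing to the shrunken domains makes the relevant part of the domain of
  -- `h_{i,j}` compact, so it has a uniform neighbourhood in that domain.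
  have hε : ∀ ij : Fin A.ν × Fin A.ν, ∃ ε > 0, ∀ p (hp : p ∈ (A.chart ij.1).U), p ∈ v ij.1 →
      p ∈ v ij.2 → ∀ w, A.transDist (A.proj ij.1 ⟨p, hp⟩) w < ε → w ∈ (A.hol ij.1 ij.2).source := by
    rintro ⟨i, j⟩
    obtain ⟨ε, hε, h⟩ := exists_uniform_nhds (O := (A.hol i j).source)
      (isCompact_proj_image i (isClosed_closure.inter isClosed_closure)
        (inter_subset_left.trans (hvU i)) : IsCompact (A.proj i '' ((↑) ⁻¹'
          (closure (v i) ∩ closure (v j))))) (A.hol i j).open_source (by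
        rintro _ ⟨p, ⟨hpi, hpj⟩, rfl⟩
        exact (A.hol_proj (hvU i hpi) (hvU j hpj)).1)
    exact ⟨ε, hε, fun p hp hpi hpj w hw =>
      h _ ⟨⟨p, hp⟩, ⟨subset_closure hpi, subset_closure hpj⟩, rfl⟩ w hw⟩
  choose ε₁ hε₁ hhol using hε
  obtain ⟨ε, hε, hεε₀, hεε₁⟩ : ∃ ε > 0, ε ≤ ε₀ ∧ ∀ ij, ε ≤ ε₁ ij := by
    refine ⟨min ε₀ (Finset.univ.inf ε₁), ?_, min_le_left _ _, fun ij =>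
      (min_le_right _ _).trans (Finset.inf_le (Finset.mem_univ ij))⟩
    exact lt_min hε₀ ((Finset.lt_inf_iff ENNReal.zero_lt_top).2 fun ij _ => hε₁ ij)
  obtain ⟨δ, hδ, hequi⟩ := hA ε hε
  -- The given holonomy map at `z` need not be defined at `z'`, so a new one is built along the
  -- chain of plaques. The bound `ε` serves the first holonomy map, the bound `δ` all later ones.
  have follow : ∀ {z z' : A.Trans}, A.transDist z z' < min δ ε → ∀ {q : M},
      A.Chained v (A.emb z) q → ∀ (j : Fin A.ν) (hq : q ∈ (A.chart j).U), q ∈ v j →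
      ∃ γ, A.PseudoStarGroup γ ∧ z ∈ γ.source ∧ z' ∈ γ.source ∧ γ z = A.proj j ⟨q, hq⟩ := by
    intro z z' hzz' q hc
    induction hc with
    | refl =>
      intro j hq hqj
      have h1 := A.hol_proj (A.emb_mem_U z) hq
      have h2 := hhol (z.1, j) _ (A.emb_mem_U z) (hvemb z) hqj
      rw [A.proj_emb] at h1 h2
      exact ⟨_, .hol z.1 j, h1.1,
        h2 z' (hzz'.trans_le ((min_le_right _ _).trans (hεε₁ _))), h1.2⟩
    | @tail p q _ hpq ih =>
      intro j hq hqj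
      obtain ⟨k, hpk, hqk, hp, hqv, heq⟩ := hpq
      obtain ⟨γ, hγ, hz, hz', hγz⟩ := ih k hpk hp
      rw [heq] at hγz
      obtain ⟨h1, h2⟩ := A.hol_proj hqk hq
      -- Equicontinuity is applied to the whole composition, so the error does not grow with the
      -- length of the chain.
      have hd := hequi γ hγ z hz z' hz' (hzz'.trans_le (min_le_left _ _))
      rw [hγz] at hd
      refine ⟨γ.trans (A.hol k j), .comp hγ (.hol k j), ?_, ?_, ?_⟩
      · rw [OpenPartialHomeomorph.trans_source]
        exact ⟨hz, by rwa [mem_preimage, hγz]⟩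
      · rw [OpenPartialHomeomorph.trans_source]
        exact ⟨hz', hhol (k, j) q hqk hqv hqj _ (hd.trans_le (hεε₁ _))⟩
      · rw [OpenPartialHomeomorph.coe_trans, Function.comp_apply, hγz, h2]
  refine isOpen_compl_iff.1 (isOpen_iff_mem_nhds.2 fun z' hz' => ?_)
  filter_upwards [eventually_transDist_lt z' (lt_min hδ hε)] with z hd hz
  rw [transDist_comm] at hd
  obtain ⟨η, hη, hzη, hηV⟩ := hz
  obtain ⟨γ, hγ, hzγ, hz'γ, hγz⟩ := follow hd
    (chained_of_pseudoStarGroup hvo hvc hsub hη hzη) _ (A.emb_mem_U (η z)) (hvemb (η z))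
  rw [A.proj_emb] at hγz
  -- The new map agrees with `η` at `z`, and takes `z'` within `ε₀` of `η z`, hence into `V`.
  refine hz' ⟨γ, hγ, hz'γ, hεV (η z) hηV _ ?_⟩
  have := hequi γ hγ z hzγ z' hz'γ (hd.trans_le (min_le_left _ _))
  rw [hγz] at this
  exact this.trans_le hεε₀

/-- In an equicontinuous matchbox manifold every leaf meets every non-empty clopen set of the
transverse space. -/
theorem Equicontinuous.saturation_eq_univ [PreconnectedSpace M] (hA : A.Equicontinuous)
    {V : Set A.Trans} (hV : IsClopen V) (hne : V.Nonempty) : A.saturation V = univ :=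
  FoliatedAtlas.saturation_eq_univ hne (isOpen_saturation hV.isOpen)
    (hA.isClosed_saturation hV).isOpen_compl

end Metric

end FoliatedAtlas

/-! ### Moving the holonomy germ into the section -/

namespace TransverseSection

variable {M : Type u} [MetricSpace M] [CompactSpace M] [PreconnectedSpace M] {n : ℕ}
  {A : FoliatedAtlas M n} {G : Type*} [Group G] (S : TransverseSection A G)

/-- A leaf with non-trivial holonomy yields an element of `G` with a fixed point at which its germ
is not that of the identity. -/
theorem exists_nontrivial_germ (hA : A.Equicontinuous) {m : M}
    (hm : A.LeafHasNontrivialHolonomy m) :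
    ∃ (g : G) (y : S.V 0), S.Φ g y = y ∧ ¬ (S.Φ g : S.V 0 → S.V 0) =ᶠ[𝓝 y] id := by
  obtain ⟨y, -, γ, hγ, hy, hfix, hgerm⟩ := hm
  obtain ⟨η, hη, hyη, hηV⟩ :=
    (hA.saturation_eq_univ (S.isClopen 0) ⟨_, S.x_mem 0⟩).ge (mem_univ y)
  have hy' : η y ∈ ((η.symm.trans γ).trans η).source := by
    simp [hyη, hy, hfix]
  have hfix' : ((η.symm.trans γ).trans η) (η y) = η y := by
    simp [hyη, hfix]
  -- Minimality supplied `η` with `η y ∈ V 0`; the conjugate of `γ` by `η` is a holonomy germ of the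
  -- section.
  obtain ⟨g, hg⟩ := S.generates _ (.comp (.comp (.symm hη) hγ) hη) ⟨η y, hηV⟩ hy'
    (by rwa [hfix'])
  refine ⟨g, ⟨η y, hηV⟩, Subtype.ext (hg.self_of_nhds.symm.trans hfix'), fun hid => hgerm ?_⟩
  -- As `V 0` is open, germs on it are germs on the whole transverse space.
  have hev : ∀ᶠ w in 𝓝 (η y), ((η.symm.trans γ).trans η) w = w := by
    have h : ∀ᶠ w : S.V 0 in 𝓝 ⟨η y, hηV⟩, ((η.symm.trans γ).trans η) (w : A.Trans) = w := by
      filter_upwards [hg, hid] with w h1 h2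
      rw [h1, h2]
      rfl
    have hmap := (S.isClopen 0).isOpen.isOpenEmbedding_subtypeVal.map_nhds_eq ⟨η y, hηV⟩
    exact hmap ▸ h
  -- Near `y` both `w` and `γ w` lie in the source of `η`, where `η` is injective and can be
  -- cancelled.
  filter_upwards [(η.continuousAt hyη).eventually hev, η.open_source.mem_nhds hyη,
    (γ.continuousAt hy).preimage_mem_nhds (by rw [hfix]; exact η.open_source.mem_nhds hyη)]
    with w h1 h2 h3
  simp only [OpenPartialHomeomorph.coe_trans, Function.comp_apply, η.left_inv h2] at h1
  exact η.injOn h3 h2 h1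

end TransverseSection

/-! ## The fibres of the Molino space over the solenoid -/

namespace PathsFrom

variable {X E : Type u} [TopologicalSpace X] [TopologicalSpace E]

/-- Concatenation with the inverse of the path class cancels it: loops act freely. -/
theorem act_right_injective {x : X} {g h : FundamentalGroup X x} {a : PathsFrom x}
    (hgh : act g a = act h a) : g = h := by
  obtain ⟨y, c⟩ := a
  have h1 : Path.Homotopic.Quotient.trans g c = Path.Homotopic.Quotient.trans h c :=
    eq_of_heq (Sigma.mk.inj hgh).2
  have h2 := congrArg (fun d => Path.Homotopic.Quotient.trans d c.symm) h1
  simpa only [Path.Homotopic.Quotient.trans_assoc, Path.Homotopic.Quotient.trans_symm,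
    Path.Homotopic.Quotient.trans_refl] using h2

/-- The loop is `b` followed by the reverse of `a`. -/
theorem exists_act_eq {x : X} {a b : PathsFrom x} (h : a.1 = b.1) :
    ∃ g : FundamentalGroup X x, act g a = b := by
  obtain ⟨y, c⟩ := a
  obtain ⟨z, d⟩ := b
  obtain rfl : y = z := h
  refine ⟨Path.Homotopic.Quotient.trans d c.symm, congrArg (Sigma.mk y) ?_⟩
  rw [Path.Homotopic.Quotient.trans_assoc, Path.Homotopic.Quotient.symm_trans,
    Path.Homotopic.Quotient.trans_refl]

theorem mk_eq_mk {x y z : X} {c : Path x y} {d : Path x z} (h : ∀ t, c t = d t) :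
    (⟨y, Path.Homotopic.Quotient.mk c⟩ : PathsFrom x) = ⟨z, Path.Homotopic.Quotient.mk d⟩ := by
  obtain rfl : y = z := by rw [← c.target, ← d.target, h]
  rw [Path.ext (funext h)]

theorem map_loop (f : C(E, X)) {e : E} {x : X} (h : f e = x) (η : FundamentalGroup E e) :
    map f h ⟨e, η⟩ = ⟨x, FundamentalGroup.mapOfEq f h η⟩ := by
  subst h
  rw [FundamentalGroup.mapOfEq_apply]
  rfl

end PathsFrom

namespace Presentation

variable {n : ℕ} (P : Presentation.{u} n)

theorem pathConnectedSpace (l : ℕ) : PathConnectedSpace (P.M l) := by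
  have := ChartedSpace.locallyPathConnectedSpace (EuclideanSpace ℝ (Fin n)) (P.M l)
  exact pathConnectedSpace_iff_connectedSpace.2 inferInstance

variable (s : P.Solenoid)

theorem lift_eq_iff {l : ℕ} {a : PathsFrom (s.1 0)} {b : PathsFrom (s.1 l)} :
    P.lift s l a = b ↔ P.push s l b = a := by
  constructor
  · rintro rfl
    exact P.push_lift s l a
  · rintro rfl
    exact (P.push_bijective s l).1 (P.push_lift s l _)

/-- A loop class lies in the image of `π₁(M_l)` iff its lift to `M_l` is closed. -/
theorem mem_imageGroup_iff {l : ℕ} {g : FundamentalGroup (P.M 0) (s.1 0)} :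
    g ∈ P.imageGroup s l ↔ (P.lift s l ⟨s.1 0, g⟩).1 = s.1 l := by
  constructor
  · rintro ⟨η, rfl⟩
    have : P.lift s l ⟨s.1 0, FundamentalGroup.mapOfEq (P.q l) (P.q_apply s l) η⟩ =
        ⟨s.1 l, η⟩ := (P.lift_eq_iff s).2 (PathsFrom.map_loop _ _ η)
    rw [this]
  · intro h
    obtain ⟨b, hb⟩ : ∃ b, P.lift s l ⟨s.1 0, g⟩ = b := ⟨_, rfl⟩
    rw [hb] at h
    obtain ⟨y, c⟩ := b
    obtain rfl : y = s.1 l := h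
    have h1 := (P.lift_eq_iff s).1 hb
    exact ⟨c, eq_of_heq (Sigma.mk.inj ((PathsFrom.map_loop (P.q l) _ c).symm.trans h1)).2⟩

/-- The class of a path in a stage of the Molino tower. -/
noncomputable def stageMk (l : ℕ) (a : PathsFrom (s.1 0)) : P.MolinoStage s l :=
  Quotient.mk (coverSetoid (s.1 0) (P.coreGroup s l)) a

theorem stageMk_act {l : ℕ} {h : FundamentalGroup (P.M 0) (s.1 0)} (hh : h ∈ P.coreGroup s l)
    (a : PathsFrom (s.1 0)) : P.stageMk s l (PathsFrom.act h a) = P.stageMk s l a :=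
  (Quotient.sound ⟨h, hh, rfl⟩ : P.stageMk s l a = _).symm

theorem stageMk_eq_iff {l : ℕ} {a b : PathsFrom (s.1 0)} :
    P.stageMk s l a = P.stageMk s l b ↔ ∃ h ∈ P.coreGroup s l, b = PathsFrom.act h a :=
  Quotient.eq (r := coverSetoid (s.1 0) (P.coreGroup s l))

/-- The end point of the lift to `M_l` is unchanged by all of the image group, not only by its core.
This is the room in the fibre of `M̂_l` over `M_l`. -/
theorem stageMap_act {l : ℕ} {h : FundamentalGroup (P.M 0) (s.1 0)} (hh : h ∈ P.imageGroup s l)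
    (a : PathsFrom (s.1 0)) : P.stageMap s l (P.stageMk s l (PathsFrom.act h a)) =
      P.stageMap s l (P.stageMk s l a) := by
  obtain ⟨η, rfl⟩ := hh
  have : P.lift s l (PathsFrom.act
      (FundamentalGroup.mapOfEq (P.q l) (P.q_apply s l) η) a) =
      PathsFrom.act η (P.lift s l a) := by
    refine (P.lift_eq_iff s).2 ((PathsFrom.map_act (P.q l) (P.q_apply s l) η _).trans ?_)
    exact congrArg _ (P.push_lift s l a)
  change (P.lift s l (PathsFrom.act _ a)).1 = (P.lift s l a).1
  rw [this]
  rfl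

theorem q_stageMap {l : ℕ} (a : PathsFrom (s.1 0)) :
    P.q l (P.stageMap s l (P.stageMk s l a)) = a.1 :=
  congrArg Sigma.fst (P.push_lift s l a)

theorem exists_stageMap_eq (l : ℕ) (y : P.M l) : ∃ a, P.stageMap s l (P.stageMk s l a) = y := by
  have := P.pathConnectedSpace l
  obtain ⟨c⟩ := PathConnectedSpace.joined (s.1 l) y
  refine ⟨P.push s l ⟨y, Path.Homotopic.Quotient.mk c⟩, ?_⟩
  exact congrArg Sigma.fst ((P.lift_eq_iff s).2 rfl)

/-- Classes over the same point of `M_l` have the same end point in `M_0`, so they differ by a loop,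
which matters only modulo the core. -/
theorem finite_stageMap_fibre (l : ℕ) [(P.coreGroup s l).FiniteIndex] (y : P.M l) :
    {z | P.stageMap s l z = y}.Finite := by
  obtain ⟨a, ha⟩ := P.exists_stageMap_eq s l y
  have : (P.coreGroup s l).Normal := Subgroup.normalCore_normal _
  refine (Set.finite_range fun k : FundamentalGroup (P.M 0) (s.1 0) ⧸ P.coreGroup s l =>
    P.stageMk s l (PathsFrom.act k.out a)).subset ?_
  rintro ⟨b⟩ (hb : P.stageMap s l (P.stageMk s l b) = y)
  obtain ⟨g, rfl⟩ := PathsFrom.exists_act_eq (a := a) (b := b) (by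
    rw [← P.q_stageMap s (l := l) a, ← P.q_stageMap s (l := l) b, ha, hb])
  obtain ⟨h, hh⟩ := QuotientGroup.mk_out_eq_mul (P.coreGroup s l) g
  refine ⟨QuotientGroup.mk g, ?_⟩
  change P.stageMk s l (PathsFrom.act _ a) = _
  -- `act` reverses products, so the core factor of the representative `g * h` is prepended last and
  -- is absorbed in the quotient.
  rw [hh, ← PathsFrom.act_act]
  exact P.stageMk_act s h.2 _

/-- The Molino space projects onto the solenoid. -/
theorem molinoMap_surjective (hfin : ∀ l, (P.coreGroup s l).FiniteIndex) :
    Function.Surjective (P.molinoMap s) := by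
  intro y
  obtain ⟨z, hz, hz'⟩ := exists_compatible_sequence
    (fun l => AssociatedCover.project (P.coreGroup_succ_le s l))
    (fun l => {z | P.stageMap s l z = y.1 l})
    (fun l => by
      have := hfin l
      exact P.finite_stageMap_fibre s l _)
    (fun l => by
      obtain ⟨a, ha⟩ := P.exists_stageMap_eq s l (y.1 l)
      exact ⟨_, ha⟩)
    (fun l z (hz : P.stageMap s (l + 1) z = y.1 (l + 1)) => by
      change P.stageMap s l _ = y.1 l
      rw [← p_stageMap, hz, y.2 l])
  exact ⟨⟨z, hz'⟩, Subtype.ext (funext hz)⟩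

/-- The fibres of the Molino space have more than one point if the discriminant group of a group
chain that is isomorphic to the chain of the presentation is non-trivial. -/
theorem nontrivial_molinoMap_fibre {G : Type*} [Group G] (H : GroupChain G)
    (hH : Nontrivial H.discriminant) (e : G ≃* FundamentalGroup (P.M 0) (s.1 0))
    (he : ∀ l g, e g ∈ P.imageGroup s l ↔ g ∈ H.sub l) (y : P.Solenoid) :
    (P.molinoMap s ⁻¹' {y}).Nontrivial := by
  have hcore : ∀ l g, e g ∈ P.coreGroup s l ↔ g ∈ H.core l := by
    intro l g
    constructor
    · intro h b
      rw [← he]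
      simpa using h (e b)
    · intro h b
      have := (he l _).2 (h (e.symm b))
      simpa using this
  have hfin : ∀ l, (P.coreGroup s l).FiniteIndex := by
    intro l
    have := H.finiteIndex l
    have : (H.core l).FiniteIndex := Subgroup.finiteIndex_normalCore _
    have hmap : P.coreGroup s l = (H.core l).comap e.symm.toMonoidHom := by
      ext g
      rw [Subgroup.mem_comap, ← hcore]
      simp
    refine hmap ▸ ⟨?_⟩
    rw [Subgroup.index_comap_of_surjective _ e.symm.surjective]
    exact Subgroup.FiniteIndex.index_ne_zero
  obtain ⟨z, hz⟩ := P.molinoMap_surjective s hfin y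
  obtain ⟨d, hd⟩ := exists_ne (1 : H.discriminant)
  choose g hg hgd using d.2.1
  choose a ha using fun l => Quotient.exists_rep (z.1 l)
  have ha : ∀ l, P.stageMk s l (a l) = z.1 l := ha
  -- Replacing the representatives `a l` and `g l` changes the translated class only by the core,
  -- because the core is normal; so the translate of `z` by `d` is again a point of the Molino
  -- space.
  have hstep : ∀ l, P.stageMk s l (PathsFrom.act (e (g (l + 1))) (a (l + 1))) =
      P.stageMk s l (PathsFrom.act (e (g l)) (a l)) := by
    intro l
    have h1 : P.stageMk s l (a (l + 1)) = P.stageMk s l (a l) := by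
      rw [ha, ← z.2 l, ← ha (l + 1)]
      rfl
    obtain ⟨h, hh, hal⟩ := (P.stageMk_eq_iff s).1 h1
    have h2 : (g (l + 1))⁻¹ * g l ∈ H.core l := by
      refine QuotientGroup.eq.1 ?_
      have h3 := d.2.2 l
      rwa [← hgd, ← hgd] at h3
    have h3 : (P.coreGroup s l).Normal := Subgroup.normalCore_normal _
    refine (P.stageMk_eq_iff s).2 ⟨(e (g (l + 1)))⁻¹ * h * e (g (l + 1)) *
      e ((g (l + 1))⁻¹ * g l), mul_mem ?_ ((hcore l _).2 h2), ?_⟩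
    · simpa using h3.conj_mem h hh (e (g (l + 1)))⁻¹
    · rw [hal, PathsFrom.act_act, PathsFrom.act_act, map_mul, map_inv]
      congr 1
      group
  refine ⟨z, hz, ⟨fun l => P.stageMk s l (PathsFrom.act (e (g l)) (a l)), hstep⟩, ?_, ?_⟩
  · rw [← hz]
    refine Subtype.ext (funext fun l => ?_)
    change P.stageMap s l (P.stageMk s l _) = P.stageMap s l (z.1 l)
    rw [P.stageMap_act s ((he l _).2 (hg l)), ha]
  · intro heq
    -- If `d` fixed `z`, freeness of the loop action would put every `g l` in the core, making `d`
    -- trivial.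
    refine hd (Subtype.ext (funext fun l => ?_))
    rw [← hgd l]
    refine (QuotientGroup.eq_one_iff _).2 ?_
    have h1 : z.1 l = P.stageMk s l (PathsFrom.act (e (g l)) (a l)) :=
      congrFun (congrArg Subtype.val heq) l
    rw [← ha, stageMk_eq_iff] at h1
    obtain ⟨h, hh, h2⟩ := h1
    rw [← hcore, PathsFrom.act_right_injective h2]
    exact hh

end Presentation

/-! ### Comparison of the group chains, and the theorem -/

namespace TransverseSection.Realization

variable {M : Type u} [MetricSpace M] {n : ℕ} {A : FoliatedAtlas M n} {G : Type*} [Group G]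
  {S : TransverseSection A G} {P : Presentation.{u} n} (R : S.Realization P)

/-- The isomorphism of `G` with `π₁(M_0)` matches the two group chains. -/
theorem e_mem_imageGroup_iff (l : ℕ) (g : G) :
    R.e g ∈ P.imageGroup (R.Θ (A.emb S.x)) l ↔ g ∈ S.stab l := by
  obtain ⟨c, h₀, h₁, hc⟩ := R.monodromy g S.base
  have hcont : Continuous fun s : P.Solenoid => s.1 l :=
    (continuous_apply l).comp continuous_subtype_val
  -- The `l`-th coordinate of the monodromy path is the lift to `M_l` of the loop `e g`. It is
  -- closed exactly when `g` keeps the base point in `V l`.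
  have hpush : P.push (R.Θ (A.emb S.x)) l
      ⟨(R.Θ (A.emb (S.Φ g S.base))).1 l, Path.Homotopic.Quotient.mk (c.map hcont)⟩ =
      ⟨(R.Θ (A.emb S.x)).1 0, R.e g⟩ := by
    rw [hc]
    exact PathsFrom.mk_eq_mk fun t => P.q_apply (c t) l
  rw [P.mem_imageGroup_iff, (P.lift_eq_iff _).2 hpush, S.mem_stab_iff]
  have hmem : R.Θ (A.emb (S.Φ g S.base)) ∈ (fun z => R.Θ (A.emb z)) '' S.V l ↔
      (S.Φ g S.base : A.Trans) ∈ S.V l :=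
    (R.Θ.injective.comp A.emb_injective).mem_set_image
  rw [R.image_V l] at hmem
  exact hmem

end TransverseSection.Realization

theorem mainTheorem5 {M : Type u} [MetricSpace M] [CompactSpace M] [ConnectedSpace M] {n : ℕ}
    (A : FoliatedAtlas M n) (hA : A.Equicontinuous)
    (hL : ∃ m : M, A.LeafHasNontrivialHolonomy m)
    {G : Type*} [Group G] (S : TransverseSection A G) :
    (∀ k : ℕ, Nontrivial (S.chain.truncate k).discriminant) ∧
    (∀ (P : Presentation.{u} n) (R : S.Realization P) (s : P.Solenoid),
      (P.molinoMap (R.Θ (A.emb S.x)) ⁻¹' {s}).Nontrivial) := by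
  obtain ⟨m, hm⟩ := hL
  obtain ⟨g, y, hy, hgerm⟩ := S.exists_nontrivial_germ hA hm
  have hdisc : ∀ k, Nontrivial (S.chain.truncate k).discriminant := fun k => by
    obtain ⟨l, hl⟩ := S.exists_not_truncate_le_core hy hgerm k
    exact GroupChain.nontrivial_discriminant _ l hl
  refine ⟨hdisc, fun P R s => ?_⟩
  -- The chain truncated at `0` lives in the subgroup `G_0 = ⊤`, which has to be identified with `G`
  -- before applying `R.e`.
  refine P.nontrivial_molinoMap_fibre _ (S.chain.truncate 0) (hdisc 0)
    (((MulEquiv.subgroupCongr S.chain.sub_zero).trans Subgroup.topEquiv).trans R.e)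
    (fun l h => ?_) s
  change R.e h ∈ _ ↔ (h : G) ∈ S.stab (0 + l)
  rw [Nat.zero_add, R.e_mem_imageGroup_iff]
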